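/- Let $p$ be a prime and $n\ge 1$. All cohomology is continuous cohomology, with finite discrete coefficients carrying the trivial action. Call an infinite pro-$p$ group $G$ a \emph{generalized Poincaré duality (GPD) group of dimension $n$} if $H^n(G,\mathbb F_p)\cong\mathbb F_p$ and, for every $0\le i\le n$, the cup product $H^i(G,\mathbb F_p)\times H^{n-i}(G,\mathbb F_p)\to H^n(G,\mathbb F_p)$ is a nondegenerate pairing (in both variables). For such a $G$ let $$I=\varinjlim_{i\in\mathbb N}\ \varinjlim_{U\le_o G} H^n(U,\mathbb Z/p^i\mathbb Z)^*,\qquad (-)^*=\operatorname{Hom}(-,\mathbb Q/\mathbb Z),$$ be its dualizing module at $p$, where $U$ runs over the open subgroups of $G$ and the transition maps are the duals of the corestrictions $H^n(V,\mathbb Z/p^i)\to H^n(U,\mathbb Z/p^i)$ ($V\le U$) and of the maps $H^n(U,\mathbb Z/p^{j})\to H^n(U,\mathbb Z/p^i)$ ($i\le j$) induced by reduction. Let ${}_pI=\{x\in I: px=0\}$. Then, as abelian groups, ${}_pI\cong\mathbb F_p$. Moreover $I$ is isomorphic, as an abelian group, either to $\mathbb Q_p/\mathbb Z_p$ or to $\mathbb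 Z/p^s\mathbb Z$ for some natural number $s\ge 1$. -/

import Mathlib

/-- A pro-`p` group: a compact, Hausdorff, totally disconnected topological group all of whose open
normal subgroups have `p`-power index. -/
structure IsProPGroup (p : ℕ) (G : Type*) [Group G] [TopologicalSpace G] : Prop where
  isTopologicalGroup : IsTopologicalGroup G
  compactSpace : CompactSpace G
  t2Space : T2Space G
  totallyDisconnectedSpace : TotallyDisconnectedSpace G
  exists_index_eq : ∀ N : OpenNormalSubgroup G, ∃ k : ℕ, (N : Subgroup G).index = p ^ k

namespace ContCoh

/-! ## Continuous cohomology with trivial discrete coefficients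

`H G A n` is the `n`-th cohomology of the complex of homogeneous continuous cochains of the
topological group `G` with values in the discrete abelian group `A` with trivial `G`-action. -/

section Complex

variable (G : Type*) [Group G] [TopologicalSpace G] (A : Type*) [AddCommGroup A]

/-- Homogeneous continuous `n`-cochains: maps `G^(n+1) → A` which are continuous for the discrete
topology of `A` and invariant under left translation. -/
def Cochain (n : ℕ) : AddSubgroup ((Fin (n + 1) → G) → A) where
  carrier := {f | IsLocallyConstant f ∧ ∀ (g : G) (x : Fin (n + 1) → G),
    f (fun i => g * x i) = f x}
  zero_mem' := ⟨IsLocallyConstant.const 0, fun _ _ => rfl⟩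
  add_mem' := fun ha hb => ⟨ha.1.add hb.1, fun g x => by simp [ha.2 g x, hb.2 g x]⟩
  neg_mem' := fun ha => ⟨ha.1.neg, fun g x => by simp [ha.2 g x]⟩

variable {G A}

theorem isLocallyConstant_sum {X ι : Type*} [TopologicalSpace X] (s : Finset ι) (f : ι → X → A)
    (h : ∀ i ∈ s, IsLocallyConstant (f i)) : IsLocallyConstant (fun x => ∑ i ∈ s, f i x) := by
  classical
  induction s using Finset.induction_on with
  | empty =>
    simp only [Finset.sum_empty]
    exact IsLocallyConstant.const (X := X) (0 : A)
  | insert a s ha ih =>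
    simp only [Finset.sum_insert ha]
    exact (h a (by simp)).add (ih fun i hi => h i (by simp [hi]))

/-- The differential `(d f)(x₀, …, xₙ₊₁) = ∑ᵢ (-1)ⁱ f(x₀, …, x̂ᵢ, …, xₙ₊₁)`. -/
def d (n : ℕ) : Cochain G A n →+ Cochain G A (n + 1) where
  toFun f := ⟨fun x => ∑ i : Fin (n + 2), (-1 : ℤ) ^ (i : ℕ) • f.1 (fun k => x (i.succAbove k)), by
    refine ⟨isLocallyConstant_sum _ _ fun i _ => ?_, fun g x => ?_⟩
    · exact (f.2.1.comp_continuous (f := fun x : Fin (n + 2) → G => fun k => x (i.succAbove k))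
        (by fun_prop)).comp (fun a : A => (-1 : ℤ) ^ (i : ℕ) • a)
    · exact Finset.sum_congr rfl fun i _ => by rw [f.2.2 g (fun k => x (i.succAbove k))]⟩
  map_zero' := by ext x; simp
  map_add' f g := by ext x; simp [Finset.sum_add_distrib]

variable (G A)

/-- Cocycles: the kernel of the differential. -/
def Cocycle (n : ℕ) : AddSubgroup (Cochain G A n) := (d n).ker

/-- Coboundaries: the image of the preceding differential (zero in degree `0`). -/
def Coboundary : (n : ℕ) → AddSubgroup (Cochain G A n)
  | 0 => ⊥
  | n + 1 => (d n).range

/-- Continuous cohomology `Hⁿ(G, A)`: cocycles modulo coboundaries. -/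
def H (n : ℕ) : Type _ := Cocycle G A n ⧸ (Coboundary G A n).addSubgroupOf (Cocycle G A n)

instance (n : ℕ) : AddCommGroup (H G A n) :=
  inferInstanceAs (AddCommGroup (Cocycle G A n ⧸ _))

end Complex

section Functoriality

variable {G : Type*} [Group G] [TopologicalSpace G] {A : Type*} [AddCommGroup A]
variable {G' : Type*} [Group G'] [TopologicalSpace G'] {A' : Type*} [AddCommGroup A']

/-- The map induced on cohomology by a map of cochain complexes. -/
def mapH (φ : ∀ n, Cochain G A n →+ Cochain G' A' n)
    (hφ : ∀ n f, d n (φ n f) = φ (n + 1) (d n f)) (n : ℕ) : H G A n →+ H G' A' n :=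
  QuotientAddGroup.map _ _
    (((φ n).comp (Cocycle G A n).subtype).codRestrict (Cocycle G' A' n) (by
      rintro ⟨f, hf⟩
      have hf' : d n f = 0 := hf
      change d n (φ n f) = 0
      rw [hφ, hf', map_zero]))
    (by
      rintro ⟨f, hf⟩ hb
      change f ∈ Coboundary G A n at hb
      change φ n f ∈ Coboundary G' A' n
      cases n with
      | zero =>
        have : f = 0 := hb
        rw [this, map_zero]
        exact zero_mem _
      | succ n =>
        obtain ⟨e, rfl⟩ := hb
        exact ⟨φ n e, hφ n e⟩)

/-- Change of coefficients on cochains: `f ↦ a ∘ f`. -/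
def coeffCochain (a : A →+ A') (n : ℕ) : Cochain G A n →+ Cochain G A' n where
  toFun f := ⟨fun x => a (f.1 x), f.2.1.comp a, fun g x => congrArg a (f.2.2 g x)⟩
  map_zero' := by ext x; simp
  map_add' f g := by ext x; simp

variable (G) in
/-- The map `Hⁿ(G, A) → Hⁿ(G, A')` induced by a homomorphism `A → A'` of coefficients. -/
def coeffMap (a : A →+ A') (n : ℕ) : H G A n →+ H G A' n :=
  mapH (coeffCochain a) (fun n f => by ext x; simp [d, coeffCochain]) n

end Functoriality

section Corestriction

variable {G : Type*} [Group G] [TopologicalSpace G] {A : Type*} [AddCommGroup A]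

/-- A `V`-equivariant retraction `U → V`, `u ↦ u σ` where `σ` is the chosen representative
of the coset `u⁻¹V`. -/
noncomputable def retract {V U : Subgroup G} (_h : V ≤ U) (u : U) : V :=
  ⟨(u * (Quotient.out (QuotientGroup.mk (u⁻¹) : U ⧸ V.subgroupOf U)) : U), by
    have h1 := (QuotientGroup.eq (s := V.subgroupOf U)).1
      (Quotient.out_eq' (QuotientGroup.mk (u⁻¹) : U ⧸ V.subgroupOf U)).symm
    simpa [Subgroup.mem_subgroupOf] using h1⟩

theorem retract_mul {V U : Subgroup G} (h : V ≤ U) (v : V) (u : U) :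
    retract h (⟨v, h v.2⟩ * u) = v * retract h u := by
  have : (QuotientGroup.mk ((⟨v, h v.2⟩ * u)⁻¹) : U ⧸ V.subgroupOf U) = QuotientGroup.mk (u⁻¹) := by
    rw [QuotientGroup.eq]
    simp [Subgroup.mem_subgroupOf]
  apply Subtype.ext
  simp only [retract]
  rw [this]
  simp [mul_assoc]

theorem continuous_retract [IsTopologicalGroup G] {V U : Subgroup G} (h : V ≤ U)
    (hV : IsOpen (V : Set G)) : Continuous (retract h) := by
  have hop : IsOpen ((V.subgroupOf U : Subgroup U) : Set U) := hV.preimage continuous_subtype_val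
  have : DiscreteTopology (U ⧸ V.subgroupOf U) := QuotientGroup.discreteTopology hop
  have h1 : Continuous (fun u : U => (QuotientGroup.mk (u⁻¹) : U ⧸ V.subgroupOf U)) :=
    QuotientGroup.continuous_mk.comp continuous_inv
  have h2 : Continuous (fun q : U ⧸ V.subgroupOf U => (Quotient.out q : U)) :=
    continuous_of_discreteTopology
  have h3 := continuous_subtype_val.comp (continuous_id.mul (h2.comp h1))
  exact h3.subtype_mk _

/-- The value of an invariant `V`-cochain, extended to `U` along the retraction and translated by
`s`, depends only on the coset `sV`. -/
theorem retract_translate {V U : Subgroup G} (h : V ≤ U) {n : ℕ} (f : Cochain V A n)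
    (s t : U) (hst : (QuotientGroup.mk s : U ⧸ V.subgroupOf U) = QuotientGroup.mk t)
    (x : Fin (n + 1) → U) :
    f.1 (fun k => retract h (s⁻¹ * x k)) = f.1 (fun k => retract h (t⁻¹ * x k)) := by
  have hv : ((s⁻¹ * t : U) : G) ∈ V := by
    simpa [Subgroup.mem_subgroupOf] using QuotientGroup.eq.1 hst
  rw [← f.2.2 ⟨_, hv⟩ (fun k => retract h (t⁻¹ * x k))]
  refine congrArg f.1 (funext fun k => ?_)
  rw [← retract_mul]
  refine congrArg (retract h) (Subtype.ext ?_)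
  simp [mul_assoc]

theorem finite_quotient_of_isOpen [IsTopologicalGroup G] [CompactSpace G] {V U : Subgroup G}
    (h : V ≤ U) (hV : IsOpen (V : Set G)) : Finite (U ⧸ V.subgroupOf U) := by
  have hU : IsClosed (U : Set G) := U.isClosed_of_isOpen (Subgroup.isOpen_mono h hV)
  have : CompactSpace U := isCompact_iff_compactSpace.mp hU.isCompact
  exact Subgroup.quotient_finite_of_isOpen _ (hV.preimage continuous_subtype_val)

open Classical in
/-- Corestriction on cochains, for subgroups `V ≤ U` of a compact group with `V` open:
`(cor f)(x₀, …, xₙ) = ∑_{σ ∈ U/V} f(r(σ⁻¹x₀), …, r(σ⁻¹xₙ))`, i.e. the norm from `V` to `U` of the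
extension of `f` along a `V`-equivariant retraction `r : U → V`. -/
noncomputable def corCochain [IsTopologicalGroup G] [CompactSpace G] {V U : Subgroup G}
    (h : V ≤ U) (hV : IsOpen (V : Set G)) (n : ℕ) : Cochain V A n →+ Cochain U A n :=
  haveI : Finite (U ⧸ V.subgroupOf U) := finite_quotient_of_isOpen h hV
  letI : Fintype (U ⧸ V.subgroupOf U) := Fintype.ofFinite _
  { toFun := fun f => ⟨fun x => ∑ c : U ⧸ V.subgroupOf U,
        f.1 (fun k => retract h ((Quotient.out c)⁻¹ * x k)), by
      refine ⟨isLocallyConstant_sum _ _ fun c _ => ?_, fun g x => ?_⟩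
      · have hr : Continuous (retract h) := continuous_retract h hV
        exact f.2.1.comp_continuous
          (f := fun x : Fin (n + 1) → U => fun k => retract h ((Quotient.out c)⁻¹ * x k))
          (by fun_prop)
      · refine Fintype.sum_equiv (MulAction.toPerm g⁻¹) _ _ fun c => ?_
        have e : ∀ k, (Quotient.out c)⁻¹ * (g * x k) = (g⁻¹ * Quotient.out c)⁻¹ * x k := by
          intro k; group
        simp only [e]
        refine retract_translate h f _ _ ?_ x
        change _ = (Quotient.mk'' (Quotient.out _) : U ⧸ V.subgroupOf U)
        rw [Quotient.out_eq', MulAction.toPerm_apply]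
        conv_rhs => rw [← Quotient.out_eq' c]
        rfl⟩
    map_zero' := by ext x; simp
    map_add' := fun f g => by ext x; simp [Finset.sum_add_distrib] }

/-- Corestriction `Hⁿ(V, A) → Hⁿ(U, A)` for subgroups `V ≤ U` of a compact group, `V` open. -/
noncomputable def cor [IsTopologicalGroup G] [CompactSpace G] {V U : Subgroup G}
    (h : V ≤ U) (hV : IsOpen (V : Set G)) (n : ℕ) : H V A n →+ H U A n :=
  mapH (fun n => corCochain h hV n) (fun n f => by
    ext x
    simp only [d, corCochain, AddMonoidHom.coe_mk, ZeroHom.coe_mk, Finset.smul_sum]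
    rw [Finset.sum_comm]) n

end Corestriction

section Cup

variable {G : Type*} [Group G] [TopologicalSpace G] {R : Type*} [CommRing R]

/-- The cup product of cochains with values in a ring:
`(f ∪ g)(x₀, …, xₙ) = f(x₀, …, xᵢ) g(xᵢ, …, xₙ)`, where `n = i + j`. -/
def cupCochain {i j n : ℕ} (h : i + j = n) :
    Cochain G R i →+ Cochain G R j →+ Cochain G R n :=
  AddMonoidHom.mk' (fun f => AddMonoidHom.mk'
    (fun g => ⟨fun x => f.1 (fun k => x ⟨k, by omega⟩) * g.1 (fun k => x ⟨i + k, by omega⟩), by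
      refine ⟨?_, fun a x => ?_⟩
      · exact (f.2.1.comp_continuous (f := fun x : Fin (n + 1) → G =>
          fun k : Fin (i + 1) => x ⟨k, by omega⟩) (by fun_prop)).mul
          (g.2.1.comp_continuous (f := fun x : Fin (n + 1) → G =>
          fun k : Fin (j + 1) => x ⟨i + k, by omega⟩) (by fun_prop))
      · exact congrArg₂ (· * ·) (f.2.2 a (fun k => x ⟨k, by omega⟩))
          (g.2.2 a (fun k => x ⟨i + k, by omega⟩))⟩)
    (fun g g' => by ext x; simp [mul_add]))
    (fun f f' => by ext x; simp [add_mul])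

/-- The Leibniz rule `d(f ∪ g) = df ∪ g + (-1)ⁱ f ∪ dg`. -/
theorem d_cupCochain {i j n : ℕ} (h : i + j = n) (f : Cochain G R i) (g : Cochain G R j) :
    d n (cupCochain h f g) = cupCochain (i := i + 1) (by omega) (d i f) g
      + (-1 : ℤ) ^ i • cupCochain (j := j + 1) (by omega) f (d j g) := by
  subst h
  ext x
  obtain ⟨X, hX⟩ : ∃ X : ℕ → G, ∀ k : Fin (i + j + 2), X k = x k :=
    ⟨fun m => if hm : m < i + j + 2 then x ⟨m, hm⟩ else 1, fun k => by simp⟩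
  have hx : ∀ m (hm : m < i + j + 2), x ⟨m, hm⟩ = X m := fun m hm => (hX ⟨m, hm⟩).symm
  have hs : ∀ (N : ℕ) (a : Fin (N + 1)) (k : Fin N),
      ((a.succAbove k : Fin (N + 1)) : ℕ) = if (k : ℕ) < a then (k : ℕ) else k + 1 := by
    intro N a k
    simp only [Fin.succAbove, Fin.lt_def, Fin.val_castSucc]
    split_ifs <;> simp
  have hxs : ∀ (a : Fin (i + j + 2)) (k : Fin (i + j + 1)),
      x (a.succAbove k) = X (if (k : ℕ) < a then (k : ℕ) else k + 1) := by
    intro a k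
    rw [← hX, hs]
  simp only [d, cupCochain, AddMonoidHom.mk'_apply, AddMonoidHom.coe_mk, ZeroHom.coe_mk,
    AddSubgroup.coe_add, AddSubgroup.coe_zsmul, Pi.add_apply, Pi.smul_apply, hxs, hx, hs]
  rw [Fin.sum_univ_eq_sum_range (n := i + j + 2) (fun a => (-1 : ℤ) ^ a •
      (f.1 (fun k => X (if (k : ℕ) < a then (k : ℕ) else k + 1)) *
       g.1 (fun k => X (if i + (k : ℕ) < a then i + (k : ℕ) else i + k + 1)))),
    Fin.sum_univ_eq_sum_range (n := i + 2) (fun a => (-1 : ℤ) ^ a •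
      f.1 (fun k => X (if (k : ℕ) < a then (k : ℕ) else k + 1))),
    Fin.sum_univ_eq_sum_range (n := j + 2) (fun a => (-1 : ℤ) ^ a •
      g.1 (fun k => X (i + (if (k : ℕ) < a then (k : ℕ) else k + 1))))]
  have hsplit : i + j + 2 = (i + 1) + (j + 1) := by omega
  rw [Finset.sum_congr (congrArg Finset.range hsplit) fun _ _ => rfl, Finset.sum_range_add,
    Finset.sum_range_succ _ (i + 1), Finset.sum_range_succ' _ (j + 1)]
  have e1 : ∀ a ∈ Finset.range (i + 1), (-1 : ℤ) ^ a •
      (f.1 (fun k => X (if (k : ℕ) < a then (k : ℕ) else k + 1)) *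
       g.1 (fun k => X (if i + (k : ℕ) < a then i + (k : ℕ) else i + k + 1))) =
      ((-1 : ℤ) ^ a • f.1 (fun k => X (if (k : ℕ) < a then (k : ℕ) else k + 1))) *
        g.1 (fun k => X (i + 1 + k)) := by
    intro a ha
    rw [smul_mul_assoc]
    congr 2
    refine congrArg g.1 (funext fun k => ?_)
    have := Finset.mem_range.1 ha
    rw [if_neg (by omega)]
    congr 1
    omega
  have e2 : ∀ a ∈ Finset.range (j + 1), (-1 : ℤ) ^ (i + 1 + a) •
      (f.1 (fun k => X (if (k : ℕ) < i + 1 + a then (k : ℕ) else k + 1)) *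
       g.1 (fun k => X (if i + (k : ℕ) < i + 1 + a then i + (k : ℕ) else i + k + 1))) =
      (-1 : ℤ) ^ i • (f.1 (fun k => X k) * ((-1 : ℤ) ^ (a + 1) •
        g.1 (fun k => X (i + (if (k : ℕ) < a + 1 then (k : ℕ) else k + 1))))) := by
    intro a ha
    rw [mul_smul_comm, smul_smul, ← pow_add, show i + (a + 1) = i + 1 + a by omega]
    congr 2
    · refine congrArg f.1 (funext fun k => ?_)
      rw [if_pos (by omega)]
    · refine congrArg g.1 (funext fun k => ?_)
      congr 1
      split_ifs <;> omega
  rw [Finset.sum_congr rfl e1, Finset.sum_congr rfl e2, ← Finset.sum_mul, ← Finset.smul_sum,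
    ← Finset.mul_sum, add_mul, mul_add, smul_add]
  have e3 : (f.1 fun k => X (if (k : ℕ) < i + 1 then (k : ℕ) else k + 1)) = f.1 fun k => X k := by
    refine congrArg f.1 (funext fun k => ?_)
    rw [if_pos (by omega)]
  have e4 : (g.1 fun k => X (i + (if (k : ℕ) < 0 then (k : ℕ) else k + 1)))
      = g.1 fun k => X (i + 1 + k) := by
    refine congrArg g.1 (funext fun k => ?_)
    rw [if_neg (by omega)]
    congr 1
    omega
  rw [e3, e4]
  simp only [pow_zero, one_smul, pow_succ, smul_mul_assoc, mul_neg, mul_one, neg_smul, neg_mul]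
  abel

theorem cupCochain_mem_cocycle {i j n : ℕ} (h : i + j = n) {f : Cochain G R i}
    {g : Cochain G R j} (hf : f ∈ Cocycle G R i) (hg : g ∈ Cocycle G R j) :
    cupCochain h f g ∈ Cocycle G R n := by
  have hf' : d i f = 0 := hf
  have hg' : d j g = 0 := hg
  change d n _ = 0
  rw [d_cupCochain, hf', hg']
  simp

theorem cupCochain_mem_coboundary_left {i j n : ℕ} (h : i + j = n) {f : Cochain G R i}
    {g : Cochain G R j} (hf : f ∈ Coboundary G R i) (hg : g ∈ Cocycle G R j) :
    cupCochain h f g ∈ Coboundary G R n := by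
  have hg' : d j g = 0 := hg
  cases i with
  | zero =>
    have : f = 0 := hf
    rw [this, map_zero]
    exact zero_mem _
  | succ i =>
    obtain ⟨e, rfl⟩ := hf
    obtain rfl : n = i + j + 1 := by omega
    refine ⟨cupCochain rfl e g, ?_⟩
    rw [d_cupCochain, hg']
    simp

theorem cupCochain_mem_coboundary_right {i j n : ℕ} (h : i + j = n) {f : Cochain G R i}
    {g : Cochain G R j} (hf : f ∈ Cocycle G R i) (hg : g ∈ Coboundary G R j) :
    cupCochain h f g ∈ Coboundary G R n := by
  have hf' : d i f = 0 := hf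
  cases j with
  | zero =>
    have : g = 0 := hg
    rw [this, map_zero]
    exact zero_mem _
  | succ j =>
    obtain ⟨e, rfl⟩ := hg
    obtain rfl : n = i + j + 1 := by omega
    refine ⟨(-1 : ℤ) ^ i • cupCochain rfl f e, ?_⟩
    rw [map_zsmul, d_cupCochain, hf']
    simp [smul_smul, ← mul_pow]

/-- The cup product `Hⁱ(G, R) × Hʲ(G, R) → Hⁿ(G, R)`, `n = i + j`, induced by multiplication
`R × R → R`. -/
def cup {i j n : ℕ} (h : i + j = n) : H G R i →+ H G R j →+ H G R n :=
  QuotientAddGroup.lift _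
    (AddMonoidHom.mk' (fun f : Cocycle G R i =>
      QuotientAddGroup.lift _
        (AddMonoidHom.mk' (fun g : Cocycle G R j =>
          (QuotientAddGroup.mk (⟨cupCochain h f.1 g.1, cupCochain_mem_cocycle h f.2 g.2⟩ :
            Cocycle G R n) : H G R n))
          (fun g g' => by
            refine congrArg (QuotientAddGroup.mk (α := Cocycle G R n)) (Subtype.ext ?_)
            simp))
        (fun g hg => (QuotientAddGroup.eq_zero_iff _).2
          (cupCochain_mem_coboundary_right h f.2 hg)))
      (fun f f' => by
        refine AddMonoidHom.ext fun g => QuotientAddGroup.induction_on g fun g => ?_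
        refine congrArg (QuotientAddGroup.mk (α := Cocycle G R n)) (Subtype.ext ?_)
        simp))
    (fun f hf => by
      refine AddMonoidHom.ext fun g => QuotientAddGroup.induction_on g fun g => ?_
      exact (QuotientAddGroup.eq_zero_iff _).2 (cupCochain_mem_coboundary_left h hf g.2))

end Cup

end ContCoh

open ContCoh

/-- A generalized Poincaré duality group of dimension `n` at the prime `p`: an infinite pro-`p`
group `G` with `Hⁿ(G, 𝔽_p) ≅ 𝔽_p` such that for all `i + j = n` the cup product pairing
`Hⁱ(G, 𝔽_p) × Hʲ(G, 𝔽_p) → Hⁿ(G, 𝔽_p)` is nondegenerate in both variables. -/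
structure IsGPD (p n : ℕ) (G : Type*) [Group G] [TopologicalSpace G] : Prop where
  isProPGroup : IsProPGroup p G
  infinite : Infinite G
  top_iso : Nonempty (H G (ZMod p) n ≃+ ZMod p)
  nondegenerate_left : ∀ (i j : ℕ) (h : i + j = n) (x : H G (ZMod p) i),
    (∀ y : H G (ZMod p) j, cup h x y = 0) → x = 0
  nondegenerate_right : ∀ (i j : ℕ) (h : i + j = n) (y : H G (ZMod p) j),
    (∀ x : H G (ZMod p) i, cup h x y = 0) → y = 0

section Dualizing

variable (p n : ℕ) (G : Type*) [Group G] [TopologicalSpace G]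

/-- The group `Hⁿ(U, ℤ/pⁱ)` for a pair `(i, U)`, with `U` an open subgroup of `G`. The pairs are
ordered by `(i, U) ≤ (j, V) ↔ i ≤ j ∧ V ≤ U`. -/
abbrev LevelH (a : ℕ × (OpenSubgroup G)ᵒᵈ) : Type _ :=
  H ((OrderDual.ofDual a.2 : OpenSubgroup G) : Subgroup G) (ZMod (p ^ a.1)) n

variable {G} [IsTopologicalGroup G] [CompactSpace G]

/-- For `i ≤ j` and `V ≤ U`, the map `Hⁿ(V, ℤ/pʲ) → Hⁿ(V, ℤ/pⁱ) → Hⁿ(U, ℤ/pⁱ)`: reduction of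
coefficients followed by corestriction. -/
noncomputable def levelMap (a b : ℕ × (OpenSubgroup G)ᵒᵈ) (h : a ≤ b) :
    LevelH p n G b →+ LevelH p n G a :=
  (cor (V := ((OrderDual.ofDual b.2 : OpenSubgroup G) : Subgroup G))
      (U := ((OrderDual.ofDual a.2 : OpenSubgroup G) : Subgroup G))
      (OrderDual.ofDual_le_ofDual.2 h.2) (OrderDual.ofDual b.2).isOpen n).comp
    (coeffMap _
      (ZMod.castHom (pow_dvd_pow p h.1) (ZMod (p ^ a.1)) : _ →+* _).toAddMonoidHom n)

variable (G)

open Classical in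
/-- The dualizing module at `p` (as an abelian group) of a compact group `G` of cohomological
dimension `n`: the direct limit, over all pairs `(i, U)`, of the Pontryagin duals
`Hⁿ(U, ℤ/pⁱ)^* = Hom(Hⁿ(U, ℤ/pⁱ), ℚ/ℤ)`, with respect to the duals of the corestrictions and of
the reductions of coefficients. -/
noncomputable abbrev DualizingModule : Type _ :=
  Module.DirectLimit (R := ℤ) (fun a : ℕ × (OpenSubgroup G)ᵒᵈ => CharacterModule (LevelH p n G a))
    (fun a b h => CharacterModule.dual (levelMap p n a b h).toIntLinearMap)

end Dualizing

/-- The group `ℚ_p/ℤ_p`. -/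
abbrev PruferGroup (p : ℕ) [Fact p.Prime] : Type :=
  ℚ_[p] ⧸ (PadicInt.subring p).toAddSubgroup

/-! Write n = m + 1. Two facts about each open subgroup V of G govern the p-torsion of I:
corestriction from Hⁿ(V, 𝔽_p) to Hⁿ(G, 𝔽_p) is bijective (`cor_injective`, `cor_surjective`), and
Hⁿ⁺¹(V, 𝔽_p) = 0 (`mem_coboundary_of_mem_cocycle`). The vanishing identifies Hⁿ(V, ℤ/pⁱ)/p with
Hⁿ(V, 𝔽_p) for i ≥ 1, and corestriction identifies the latter with one fixed copy of 𝔽_p. So the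
characters killed by p form a constant system of groups of order p, and its limit is the p-torsion
of I (`exists_socle_generator`). A p-primary group with such a socle embeds in ℚ_p/ℤ_p, because the
latter is divisible; bounded exponent makes it finite cyclic, unbounded exponent makes it everything
(`nonempty_addEquiv_pruferGroup_or_zmod`).

The heart is a duality statement in degree n for finite modules M, `exists_sub_rawD_mem`: a class in
Hⁿ(Γ, M) vanishes once all its images under invariant functionals M → 𝔽_p vanish. The proof is by
induction along 0 → M' → M → 𝔽_p → 0. The class is first moved into M'. An invariant functional f on
M' extends invariantly to M exactly when an obstruction c_f in H¹(Γ, 𝔽_p) vanishes, so the image of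
the class under f depends only on c_f. Nondegeneracy of H¹ × Hᵐ → Hⁿ then writes all these images as
c_f ∪ z with a single z, and they are killed by subtracting the image of z under the connecting map
Hᵐ(𝔽_p) → Hⁿ(M'). No other cup product pairing is needed.

For M the functions on the cosets of V, every invariant functional is a multiple of the sum, and
Shapiro's lemma turns the duality statement into injectivity of corestriction. Surjectivity uses
that Γ is infinite: there is an open W < V, and the sum over the cosets of W kills functions on the
cosets of V because p divides the index. This makes an arbitrary lift of a cocycle a coboundary over
W, modulo the kernel of the sum over V, and that coboundary is a closed lift over V
(`exists_isCochain_cosetSum_eq`). Closed lifts then exist for all finite modules, so Hⁿ⁺¹ preserves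
injections; since classes die in a larger module of functions, Hⁿ⁺¹ vanishes.

Everything is done with explicit homogeneous cochains. A quotient module B/B₀ appears as a pair of
subspaces of one ambient representation, with equations holding modulo B₀. -/

namespace ContCoh

/-! ## The homogeneous differential on arbitrary functions -/

section RawCalculus

variable {Ω Γ Δ A A' : Type*} [AddCommGroup A] [AddCommGroup A']

/-- The alternating sum `(d φ)(x₀, …, xₙ) = ∑ᵢ (-1)ⁱ φ(x₀, …, x̂ᵢ, …, xₙ)` for an arbitrary function
`φ` of `n` variables. -/
def rawD {n : ℕ} (φ : (Fin n → Ω) → A) (x : Fin (n + 1) → Ω) : A :=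
  ∑ i : Fin (n + 1), (-1 : ℤ) ^ (i : ℕ) • φ (fun k => x (i.succAbove k))

theorem rawD_add {n : ℕ} (φ ψ : (Fin n → Ω) → A) :
    rawD (fun x => φ x + ψ x) = fun x => rawD φ x + rawD ψ x := by
  funext x
  simp [rawD, Finset.sum_add_distrib]

theorem rawD_sub {n : ℕ} (φ ψ : (Fin n → Ω) → A) :
    rawD (fun x => φ x - ψ x) = fun x => rawD φ x - rawD ψ x := by
  funext x
  simp [rawD, smul_sub, Finset.sum_sub_distrib]

theorem rawD_sum {n : ℕ} {ι : Type*} (s : Finset ι) (φ : ι → (Fin n → Ω) → A) :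
    rawD (fun x => ∑ c ∈ s, φ c x) = fun x => ∑ c ∈ s, rawD (φ c) x := by
  funext x
  simp only [rawD, Finset.smul_sum]
  rw [Finset.sum_comm]

theorem rawD_map {n : ℕ} {F : Type*} [FunLike F A A'] [AddMonoidHomClass F A A'] (f : F)
    (φ : (Fin n → Ω) → A) : rawD (fun x => f (φ x)) = fun x => f (rawD φ x) := by
  funext x
  simp [rawD, map_sum, map_zsmul]

theorem rawD_comp {n : ℕ} (r : Γ → Ω) (φ : (Fin n → Ω) → A) :
    rawD (fun x : Fin n → Γ => φ (fun i => r (x i))) = fun x => rawD φ (fun i => r (x i)) := rfl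

theorem rawD_zero {n : ℕ} : rawD (fun _ : Fin n → Ω => (0 : A)) = fun _ => 0 := by
  funext x
  simp [rawD]

/-- The differential of the contraction `x ↦ φ (a, x)`. -/
theorem rawD_cons {n : ℕ} (φ : (Fin (n + 1) → Ω) → A) (a : Ω) (x : Fin (n + 1) → Ω) :
    rawD φ (Fin.cons a x) = φ x - rawD (fun y => φ (Fin.cons a y)) x := by
  rw [rawD, Fin.sum_univ_succ]
  have h : ∀ i : Fin (n + 1), (fun k => (Fin.cons a x : Fin (n + 2) → Ω) (i.succ.succAbove k)) =
      Fin.cons a (fun k => x (i.succAbove k)) := by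
    intro i
    funext k
    refine Fin.cases ?_ (fun k => ?_) k
    · simp
    · simp [Fin.succ_succAbove_succ]
  simp only [h]
  simp [rawD, pow_succ, sub_eq_add_neg]

/-- Contracting the first variable lowers the number of variables, so induction replaces the usual
cancellation of terms in pairs. -/
theorem rawD_rawD {n : ℕ} (φ : (Fin n → Ω) → A) (x : Fin (n + 2) → Ω) : rawD (rawD φ) x = 0 := by
  induction n with
  | zero =>
    have h : ∀ y : Fin 0 → Ω, φ y = φ Fin.elim0 := fun y => congrArg φ (Subsingleton.elim _ _)
    simp [rawD, Fin.sum_univ_succ, h]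
  | succ n ih =>
    rw [← Fin.cons_self_tail x, rawD_cons]
    have h : (fun y => rawD φ (Fin.cons (x 0) y)) =
        fun y => φ y - rawD (fun z => φ (Fin.cons (x 0) z)) y := by
      funext y
      exact rawD_cons φ (x 0) y
    rw [h, rawD_sub]
    simp [ih]

/-- The prism operator `φ ↦ ∑ᵢ (-1)ⁱ φ(s x₀, …, s xᵢ, r xᵢ, …, r xₙ₋₁)`. -/
def prism (r s : Γ → Ω) : (n : ℕ) → ((Fin (n + 1) → Ω) → A) → (Fin n → Γ) → A
  | 0, _, _ => 0
  | n + 1, φ, x => φ (Fin.cons (s (x 0)) (Fin.cons (r (x 0)) (fun i => r (Fin.tail x i)))) -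
      prism r s n (fun z => φ (Fin.cons (s (x 0)) z)) (Fin.tail x)

theorem prism_sub (r s : Γ → Ω) {n : ℕ} (φ ψ : (Fin (n + 1) → Ω) → A) (x : Fin n → Γ) :
    prism r s n (fun z => φ z - ψ z) x = prism r s n φ x - prism r s n ψ x := by
  induction n with
  | zero => simp [prism]
  | succ n ih =>
    simp only [prism, ih]
    abel

theorem prism_zero (r s : Γ → Ω) {n : ℕ} (x : Fin n → Γ) :
    prism r s n (fun _ => (0 : A)) x = 0 := by
  induction n with
  | zero => simp [prism]
  | succ n ih => simp [prism, ih]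

/-- The prism operator is a homotopy between the maps induced by `r` and `s`. -/
theorem rawD_prism (r s : Γ → Ω) {n : ℕ} (φ : (Fin (n + 1) → Ω) → A) (x : Fin (n + 1) → Γ) :
    rawD (prism r s n φ) x + prism r s (n + 1) (rawD φ) x =
      φ (fun i => r (x i)) - φ (fun i => s (x i)) := by
  have hcons : ∀ {m : ℕ} (f : Γ → Ω) (a : Γ) (y : Fin m → Γ),
      (fun i => f ((Fin.cons a y : Fin (m + 1) → Γ) i)) = Fin.cons (f a) (fun i => f (y i)) := by
    intro m f a y
    funext i
    refine Fin.cases ?_ (fun k => ?_) i <;> simp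
  induction n with
  | zero =>
    obtain ⟨a, y, rfl⟩ : ∃ a y, x = Fin.cons a y := ⟨_, _, (Fin.cons_self_tail x).symm⟩
    have h1 : rawD (prism r s 0 φ) (Fin.cons a y) = 0 := by simp [rawD, prism]
    simp only [prism, Fin.tail_cons, Fin.cons_zero, rawD_cons, hcons]
    have h2 : ∀ y : Fin 0 → Ω, y = Fin.elim0 := fun y => Subsingleton.elim _ _
    simp [rawD, h2]
  | succ n ih =>
    obtain ⟨a, y, rfl⟩ : ∃ a y, x = Fin.cons a y := ⟨_, _, (Fin.cons_self_tail x).symm⟩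
    -- The recursion of `prism` fixes the first argument at `s a`, so the induction hypothesis is
    -- needed for this contraction of `φ`.
    have ih' := ih (fun z => φ (Fin.cons (s a) z)) y
    have e1 : (fun z => prism r s (n + 1) φ (Fin.cons a z)) = fun z =>
        φ (Fin.cons (s a) (Fin.cons (r a) (fun i => r (z i)))) -
          prism r s n (fun w => φ (Fin.cons (s a) w)) z := by
      funext z
      simp [prism]
    have e2 : (fun z => rawD φ (Fin.cons (s a) z)) = fun z =>
        φ z - rawD (fun w => φ (Fin.cons (s a) w)) z := by
      funext z
      rw [rawD_cons]
    have e3 : prism r s (n + 2) (rawD φ) (Fin.cons a y) =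
        rawD φ (Fin.cons (s a) (Fin.cons (r a) (fun i => r (y i)))) -
          prism r s (n + 1) (fun z => rawD φ (Fin.cons (s a) z)) y := by
      simp [prism]
    rw [rawD_cons, e1, rawD_sub, e3, e2, prism_sub, rawD_cons, rawD_cons, hcons, hcons]
    have e4 := rawD_comp r (fun z => φ (Fin.cons (s a) (Fin.cons (r a) z)))
    simp only [e4]
    rw [← sub_eq_zero] at ih' ⊢
    rw [← ih']
    abel

theorem prism_comp (r s : Γ → Ω) (τ : Δ → Γ) {n : ℕ} (φ : (Fin (n + 1) → Ω) → A)
    (x : Fin n → Δ) :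
    prism r s n φ (fun i => τ (x i)) = prism (fun y => r (τ y)) (fun y => s (τ y)) n φ x := by
  induction n with
  | zero => rfl
  | succ n ih =>
    simp only [prism]
    rw [← ih]
    rfl

theorem prism_comp_left (r s : Γ → Ω) (b : Ω → Δ) {n : ℕ} (φ : (Fin (n + 1) → Δ) → A)
    (x : Fin n → Γ) :
    prism (fun y => b (r y)) (fun y => b (s y)) n φ x =
      prism r s n (fun z => φ (fun i => b (z i))) x := by
  have hcons : ∀ {m : ℕ} (a : Ω) (y : Fin m → Ω),
      (fun i => b ((Fin.cons a y : Fin (m + 1) → Ω) i)) = Fin.cons (b a) (fun i => b (y i)) := by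
    intro m a y
    funext i
    refine Fin.cases ?_ (fun k => ?_) i <;> simp
  induction n with
  | zero => rfl
  | succ n ih =>
    simp only [prism, ih, hcons]

theorem isLocallyConstant_rawD [TopologicalSpace Ω] {n : ℕ} {φ : (Fin n → Ω) → A}
    (hφ : IsLocallyConstant φ) : IsLocallyConstant (rawD φ) :=
  isLocallyConstant_sum _ _ fun i _ =>
    (hφ.comp_continuous (f := fun x : Fin (n + 1) → Ω => fun k => x (i.succAbove k))
      (by fun_prop)).comp (fun a : A => (-1 : ℤ) ^ (i : ℕ) • a)

theorem continuous_cons {W : Type*} [TopologicalSpace W] [TopologicalSpace Ω] {m : ℕ} {a : W → Ω}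
    {g : W → Fin m → Ω} (ha : Continuous a) (hg : Continuous g) :
    Continuous fun w => (Fin.cons (a w) (g w) : Fin (m + 1) → Ω) :=
  Continuous.finCons (A := fun _ => Ω) ha hg

/-- The parameter space `Z` is what lets the induction run: each step of the recursion freezes an
argument of `φ` that itself varies with the point. -/
theorem isLocallyConstant_prism_family {Z : Type*} [TopologicalSpace Ω] [TopologicalSpace Γ]
    [TopologicalSpace Z] {r s : Γ → Ω} (hr : Continuous r) (hs : Continuous s) {n : ℕ}
    (φ : Z → (Fin (n + 1) → Ω) → A)
    (hφ : IsLocallyConstant (fun q : Z × (Fin (n + 1) → Ω) => φ q.1 q.2))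
    (y : Z → Fin n → Γ) (hy : Continuous y) :
    IsLocallyConstant (fun z => prism r s n (φ z) (y z)) := by
  induction n generalizing Z with
  | zero => exact IsLocallyConstant.const 0
  | succ n ih =>
    have hy' : ∀ i, Continuous fun z => y z i := fun i => (continuous_apply i).comp hy
    simp only [prism]
    refine IsLocallyConstant.sub ?_ ?_
    · refine hφ.comp_continuous (f := fun z => (z, _)) (continuous_id.prodMk ?_)
      refine continuous_cons (hs.comp (hy' 0)) (continuous_cons (hr.comp (hy' 0)) ?_)
      exact continuous_pi fun i => hr.comp (hy' _)
    · refine ih (fun z w => φ z (Fin.cons (s (y z 0)) w)) ?_ _ (continuous_pi fun i => hy' _)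
      refine hφ.comp_continuous
        (f := fun q : Z × (Fin (n + 1) → Ω) => (q.1, Fin.cons (s (y q.1 0)) q.2))
        (continuous_fst.prodMk ?_)
      have h0 : Continuous fun q : Z × (Fin (n + 1) → Ω) => s (y q.1 0) :=
        (hs.comp (hy' 0)).comp continuous_fst
      exact continuous_cons (g := fun q : Z × (Fin (n + 1) → Ω) => q.2) h0 continuous_snd

theorem isLocallyConstant_prism [TopologicalSpace Ω] [TopologicalSpace Γ] {r s : Γ → Ω}
    (hr : Continuous r) (hs : Continuous s) {n : ℕ} {φ : (Fin (n + 1) → Ω) → A}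
    (hφ : IsLocallyConstant φ) : IsLocallyConstant (prism r s n φ) :=
  isLocallyConstant_prism_family hr hs (fun _ => φ)
    (hφ.comp_continuous continuous_snd) _ continuous_id

end RawCalculus

/-! ## Linear functionals and cup products with degree one classes -/

/-- A functional on a space paired nondegenerately on one side is represented by an element of the
other side as soon as it factors through a finite-dimensional subspace. -/
theorem exists_representing {k Λ V₁ V₂ : Type*} [Field k] [AddCommGroup Λ] [Module k Λ]
    [AddCommGroup V₁] [Module k V₁] [AddCommGroup V₂] [Module k V₂] (β : V₁ →ₗ[k] V₂ →ₗ[k] k)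
    (hβ : Function.Injective β) (Φ : Λ →ₗ[k] V₁) [FiniteDimensional k Φ.range] (Ψ : Λ →ₗ[k] k)
    (h : Φ.ker ≤ Ψ.ker) : ∃ z, ∀ f, Ψ f = β (Φ f) z := by
  obtain ⟨θ, hθ⟩ : ∃ θ : Φ.range →ₗ[k] k, θ ∘ₗ Φ.rangeRestrict = Ψ := by
    refine ⟨(Φ.ker.liftQ Ψ h) ∘ₗ Φ.quotKerEquivRange.symm.toLinearMap, ?_⟩
    ext f
    have : Φ.quotKerEquivRange.symm (Φ.rangeRestrict f) = Submodule.Quotient.mk f := by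
      rw [LinearEquiv.symm_apply_eq]
      rfl
    simp [this]
  have hinj : Function.Injective (β ∘ₗ Φ.range.subtype) :=
    hβ.comp Φ.range.injective_subtype
  -- Finite dimension of the range enters here: a pairing injective on that side realizes every
  -- functional on it.
  have hsurj : Function.Surjective (β ∘ₗ Φ.range.subtype).flip :=
    LinearMap.flip_injective_iff₂.1 (by simpa using hinj)
  obtain ⟨z, hz⟩ := hsurj θ
  exact ⟨z, fun f => by rw [← hθ, ← hz]; rfl⟩

section Cup

variable {p : ℕ} [Fact p.Prime] {Γ : Type*} [Group Γ] [TopologicalSpace Γ]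

theorem nsmul_eq_zero {N : ℕ} (i : ℕ) (x : H Γ (ZMod N) i) : N • x = 0 := by
  obtain ⟨f, rfl⟩ := QuotientAddGroup.mk_surjective x
  have : N • f = 0 := by
    ext x
    simp
  exact (map_nsmul (QuotientAddGroup.mk' _) N f).symm.trans
    ((congrArg (QuotientAddGroup.mk' _) this).trans (map_zero _))

theorem mk_eq_mk_iff {A : Type*} [AddCommGroup A] {n : ℕ} (f g : Cocycle Γ A n) :
    (QuotientAddGroup.mk f : H Γ A n) = QuotientAddGroup.mk g ↔
      (f : Cochain Γ A n) - g ∈ Coboundary Γ A n := by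
  rw [QuotientAddGroup.eq, ← neg_mem_iff, AddSubgroup.mem_addSubgroupOf]
  simp [sub_eq_add_neg, add_comm]

theorem mk_eq_zero_iff {A : Type*} [AddCommGroup A] {n : ℕ} (f : Cocycle Γ A n) :
    (QuotientAddGroup.mk f : H Γ A n) = 0 ↔ (f : Cochain Γ A n) ∈ Coboundary Γ A n := by
  rw [QuotientAddGroup.eq_zero_iff, AddSubgroup.mem_addSubgroupOf]

theorem mem_coboundary_succ {A : Type*} [AddCommGroup A] {n : ℕ} {f : Cochain Γ A (n + 1)}
    (g : Cochain Γ A n) (h : ∀ x, rawD g.1 x = f.1 x) : f ∈ Coboundary Γ A (n + 1) :=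
  ⟨g, Subtype.ext (funext h)⟩

/-- The hypothesis says that the class of `u f` depends only on the class of `c f`; nondegeneracy
against H¹ turns this dependence into the cup product with one class. Finiteness of the range of `c`
stands in for finiteness of H¹, which is not known. -/
theorem exists_cup_representing {m : ℕ} (hG : IsGPD p (m + 1) Γ) {Λ : Type*} [AddCommGroup Λ]
    [Module (ZMod p) Λ] (c : Λ →+ Cocycle Γ (ZMod p) 1) (u : Λ →+ Cocycle Γ (ZMod p) (m + 1))
    (hfin : (Set.range c).Finite)
    (h : ∀ f, (c f : Cochain Γ (ZMod p) 1) ∈ Coboundary Γ (ZMod p) 1 →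
      (u f : Cochain Γ (ZMod p) (m + 1)) ∈ Coboundary Γ (ZMod p) (m + 1)) :
    ∃ z : Cocycle Γ (ZMod p) m, ∀ f, (u f : Cochain Γ (ZMod p) (m + 1)) -
      cupCochain (add_comm 1 m) (c f).1 z.1 ∈ Coboundary Γ (ZMod p) (m + 1) := by
  let _ (i : ℕ) : Module (ZMod p) (H Γ (ZMod p) i) := AddCommGroup.zmodModule (nsmul_eq_zero i)
  obtain ⟨e⟩ := hG.top_iso
  let q (i : ℕ) : Cocycle Γ (ZMod p) i →+ H Γ (ZMod p) i := QuotientAddGroup.mk' _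
  let Φ : Λ →ₗ[ZMod p] H Γ (ZMod p) 1 := ((q 1).comp c).toZModLinearMap p
  let Ψ : Λ →ₗ[ZMod p] ZMod p := (e.toAddMonoidHom.comp ((q (m + 1)).comp u)).toZModLinearMap p
  let β : H Γ (ZMod p) 1 →ₗ[ZMod p] H Γ (ZMod p) m →ₗ[ZMod p] ZMod p :=
    (AddMonoidHom.mk' (fun x =>
      (e.toAddMonoidHom.comp (cup (add_comm 1 m) x)).toZModLinearMap p)
      (fun x y => by ext z; simp)).toZModLinearMap p
  have hβ : Function.Injective β := by
    refine (injective_iff_map_eq_zero β).2 fun x hx => ?_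
    refine hG.nondegenerate_left 1 m (add_comm 1 m) x fun y => ?_
    have : e (cup (add_comm 1 m) x y) = 0 := LinearMap.congr_fun hx y
    exact (map_eq_zero_iff e e.injective).1 this
  have hf : (Set.range Φ).Finite := by
    have : Set.range Φ = q 1 '' Set.range c := by
      rw [← Set.range_comp]
      rfl
    rw [this]
    exact hfin.image _
  have : Finite Φ.range := hf.to_subtype
  obtain ⟨z, hz⟩ := exists_representing β hβ Φ Ψ (fun f hf => by
    have h1 : q 1 (c f) = 0 := hf
    have h2 := h f ((mk_eq_zero_iff (c f)).1 h1)
    have h3 : q (m + 1) (u f) = 0 := (mk_eq_zero_iff (u f)).2 h2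
    change e (q (m + 1) (u f)) = 0
    rw [h3, map_zero])
  obtain ⟨z, rfl⟩ := QuotientAddGroup.mk_surjective z
  refine ⟨z, fun f => ?_⟩
  have h1 : e (q (m + 1) (u f)) = e (cup (add_comm 1 m) (q 1 (c f)) (q m z)) := hz f
  exact (mk_eq_mk_iff (u f) ⟨_, cupCochain_mem_cocycle (add_comm 1 m) (c f).2 z.2⟩).1
    (e.injective h1)

end Cup

/-! ## Cochains with values in a representation -/

section Cochains

variable {k Γ A : Type*} [Field k] [Group Γ] [AddCommGroup A] [Module k A]

/-- Leibniz rule for the product of `z` with the 0-cochain given by the orbit of `b`. For closed `z`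
only the last term survives; it represents the connecting map applied to `z`. -/
theorem rawD_smul (ρ : Representation k Γ A) (b : A) (z : (Fin (n + 1) → Γ) → k)
    (x : Fin (n + 2) → Γ) :
    rawD (fun x : Fin (n + 1) → Γ => z x • ρ (x 0) b) x =
      rawD z x • ρ (x 0) b + z (fun i => x i.succ) • (ρ (x 1) b - ρ (x 0) b) := by
  have h : rawD z x • ρ (x 0) b = z (fun i => x i.succ) • ρ (x 0) b + ∑ i : Fin (n + 1),
      (-1 : ℤ) ^ ((i.succ : Fin (n + 2)) : ℕ) •
        (z (fun j => x (i.succ.succAbove j)) • ρ (x 0) b) := by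
    simp only [rawD, Finset.sum_smul]
    rw [Fin.sum_univ_succ]
    simp only [Fin.val_zero, pow_zero, one_smul, Fin.succAbove_zero, smul_assoc]
  rw [h, rawD, Fin.sum_univ_succ]
  simp only [Fin.val_zero, pow_zero, one_smul, Fin.succAbove_zero, Fin.succ_succAbove_zero,
    Fin.succ_zero_eq_one, smul_sub]
  abel

/-- A functional which is invariant on `B`. -/
def InvariantOn (ρ : Representation k Γ A) (B : Submodule k A) (f : A →ₗ[k] k) : Prop :=
  ∀ g, ∀ b ∈ B, f (ρ g b) = f b

variable [TopologicalSpace Γ]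

/-- Homogeneous continuous cochains in `n` variables with values in a subspace `B` of a
representation. -/
structure IsCochain (ρ : Representation k Γ A) (B : Submodule k A) {n : ℕ}
    (X : (Fin n → Γ) → A) : Prop where
  isLocallyConstant : IsLocallyConstant X
  map_mul : ∀ (g : Γ) (x : Fin n → Γ), X (fun i => g * x i) = ρ g (X x)
  mem : ∀ x, X x ∈ B

/-- A subspace `B` of a representation which is finite, stable and on which the action is
continuous. -/
structure IsSmooth (ρ : Representation k Γ A) (B : Submodule k A) : Prop where
  finite : Finite B
  stable : ∀ g, ∀ b ∈ B, ρ g b ∈ B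
  isLocallyConstant : ∀ b ∈ B, IsLocallyConstant fun g => ρ g b

variable {ρ : Representation k Γ A} {B B' : Submodule k A} {n : ℕ}

namespace IsCochain

theorem mono {X : (Fin n → Γ) → A} (hX : IsCochain ρ B X) (h : ∀ x, X x ∈ B') :
    IsCochain ρ B' X := ⟨hX.1, hX.2, h⟩

theorem sub {X Y : (Fin n → Γ) → A} (hX : IsCochain ρ B X) (hY : IsCochain ρ B Y) :
    IsCochain ρ B (fun x => X x - Y x) :=
  ⟨hX.1.sub hY.1, fun g x => by rw [hX.2, hY.2, map_sub], fun x => sub_mem (hX.3 x) (hY.3 x)⟩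

theorem add {X Y : (Fin n → Γ) → A} (hX : IsCochain ρ B X) (hY : IsCochain ρ B Y) :
    IsCochain ρ B (fun x => X x + Y x) :=
  ⟨hX.1.add hY.1, fun g x => by rw [hX.2, hY.2, map_add], fun x => add_mem (hX.3 x) (hY.3 x)⟩

theorem rawD {X : (Fin n → Γ) → A} (hX : IsCochain ρ B X) : IsCochain ρ B (rawD X) := by
  refine ⟨isLocallyConstant_rawD hX.1, fun g x => ?_, fun x => ?_⟩
  · simp only [ContCoh.rawD, map_sum, map_zsmul]
    exact Finset.sum_congr rfl fun i _ => by rw [hX.2 g (fun k => x (i.succAbove k))]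
  · exact sum_mem fun i _ => B.toAddSubgroup.zsmul_mem (hX.3 _) _

/-- The cochain obtained by applying an invariant functional. -/
def map {X : (Fin (n + 1) → Γ) → A} (hX : IsCochain ρ B X) {f : A →ₗ[k] k}
    (hf : InvariantOn ρ B f) : Cochain Γ k n :=
  ⟨fun x => f (X x), hX.1.comp f, fun g x => (congrArg f (hX.2 g x)).trans (hf g _ (hX.3 x))⟩

theorem map_mem_cocycle {X : (Fin (n + 1) → Γ) → A} (hX : IsCochain ρ B X) {f : A →ₗ[k] k}
    (hf : InvariantOn ρ B f) (h : ∀ x, f (ContCoh.rawD X x) = 0) :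
    hX.map hf ∈ Cocycle Γ k n := by
  refine Subtype.ext (funext fun x => ?_)
  exact (congrFun (rawD_map f X) x).trans (h x)

/-- The cochain `x ↦ z(x) • x₀ b`. -/
theorem smul {b : A} (hB : IsSmooth ρ B) (hb : b ∈ B) (z : Cochain Γ k n) :
    IsCochain ρ B (fun x : Fin (n + 1) → Γ => z.1 x • ρ (x 0) b) := by
  refine ⟨?_, fun g x => ?_, fun x => B.smul_mem _ (hB.stable _ _ hb)⟩
  · have h := (hB.isLocallyConstant b hb).comp_continuous
      (f := fun x : Fin (n + 1) → Γ => x 0) (continuous_apply 0)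
    exact (z.2.1.prodMk h).comp fun q : k × A => q.1 • q.2
  · simp [z.2.2 g x]

end IsCochain

end Cochains

/-! ### Dévissage: duality in the top degree for finite modules -/

section Devissage

variable {p : ℕ} [Fact p.Prime] {Γ A : Type*} [Group Γ] [TopologicalSpace Γ]
  [AddCommGroup A] [Module (ZMod p) A] {ρ : Representation (ZMod p) Γ A}
  {B B₀ : Submodule (ZMod p) A}

theorem IsSmooth.mono (hB : IsSmooth ρ B) (h : B₀ ≤ B) (hs : ∀ g, ∀ b ∈ B₀, ρ g b ∈ B₀) :
    IsSmooth ρ B₀ :=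
  have := hB.finite
  ⟨Finite.of_injective _ (Submodule.inclusion_injective h), hs,
    fun b hb => hB.isLocallyConstant b (h hb)⟩

theorem IsSmooth.exists_openNormalSubgroup [IsTopologicalGroup Γ] [CompactSpace Γ]
    (hB : IsSmooth ρ B) : ∃ N : OpenNormalSubgroup Γ, ∀ g ∈ N, ∀ b ∈ B, ρ g b = b := by
  have := hB.finite
  have hW : IsClopen (⋂ b : B, {g : Γ | ρ g b = b}) :=
    isClopen_iInter_of_finite fun b => (hB.isLocallyConstant b.1 b.2).isClopen_fiber b.1
  obtain ⟨N, hN⟩ := IsTopologicalGroup.exist_openNormalSubgroup_sub_clopen_nhds_of_one hW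
    (by simp)
  exact ⟨N, fun g hg b hb => Set.mem_iInter.1 (hN hg) ⟨b, hb⟩⟩

/-- A proper stable subspace is annihilated by a nonzero invariant functional. -/
theorem IsSmooth.exists_invariantOn [IsTopologicalGroup Γ] [CompactSpace Γ]
    (hΓ : IsProPGroup p Γ) (hB : IsSmooth ρ B) (hs : ∀ g, ∀ b ∈ B₀, ρ g b ∈ B₀) (hlt : B₀ < B) :
    ∃ π : A →ₗ[ZMod p] ZMod p, InvariantOn ρ B π ∧ (∀ b ∈ B₀, π b = 0) ∧ ∃ b ∈ B, π b = 1 := by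
  classical
  have hBfin := hB.finite
  -- The dual of B/B₀ is a nonzero finite `p`-group on which Γ acts through a finite `p`-group, so
  -- counting fixed points yields one other than zero.
  let D : Submodule (ZMod p) (B →ₗ[ZMod p] ZMod p) := (B₀.comap B.subtype).dualAnnihilator
  have hDfin : Finite D :=
    have : Finite (B →ₗ[ZMod p] ZMod p) := DFunLike.finite _
    inferInstance
  let r (g : Γ) : B →ₗ[ZMod p] B := (ρ g).restrict (hB.stable g)
  have hr1 : r 1 = LinearMap.id := by ext; simp [r]
  have hrmul : ∀ g h, r (g * h) = r g ∘ₗ r h := fun g h => by ext; simp [r]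
  let act : MulAction Γ D :=
    { smul := fun g f => ⟨f.1 ∘ₗ r g⁻¹, by
        have hf := f.2
        rw [Submodule.mem_dualAnnihilator] at hf ⊢
        exact fun w hw => hf _ (hs _ _ hw)⟩
      one_smul := fun f => Subtype.ext (by
        change f.1 ∘ₗ r 1⁻¹ = f.1
        rw [inv_one, hr1, LinearMap.comp_id])
      mul_smul := fun g h f => Subtype.ext (by
        change f.1 ∘ₗ r (g * h)⁻¹ = (f.1 ∘ₗ r h⁻¹) ∘ₗ r g⁻¹
        rw [mul_inv_rev, hrmul, LinearMap.comp_assoc]) }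
  have hact : ∀ (g : Γ) (f : D), (g • f).1 = f.1 ∘ₗ r g⁻¹ := fun _ _ => rfl
  obtain ⟨N, hN⟩ := hB.exists_openNormalSubgroup
  have hP : IsPGroup p (MulAction.toPermHom Γ D).range := by
    rintro ⟨_, g, rfl⟩
    obtain ⟨j, hj⟩ := hΓ.exists_index_eq N
    refine ⟨j, Subtype.ext ?_⟩
    have hmem : g ^ p ^ j ∈ (N : Subgroup Γ) := hj ▸ Subgroup.pow_index_mem (N : Subgroup Γ) g
    change MulAction.toPermHom Γ D g ^ p ^ j = 1
    rw [← map_pow]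
    refine Equiv.ext fun f => Subtype.ext (LinearMap.ext fun b => ?_)
    change f.1 (r (g ^ p ^ j)⁻¹ b) = f.1 b
    refine congrArg f.1 (Subtype.ext ?_)
    exact hN _ (inv_mem hmem) _ b.2
  have hlt' : B₀.comap B.subtype < ⊤ := by
    refine lt_top_iff_ne_top.2 fun h => hlt.not_ge fun b hb => ?_
    have : (⟨b, hb⟩ : B) ∈ B₀.comap B.subtype := h ▸ Submodule.mem_top
    exact this
  obtain ⟨f, hf, hf'⟩ := Submodule.exists_le_ker_of_lt_top _ hlt'
  have hdvd : p ∣ Nat.card D := by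
    obtain ⟨F, hF⟩ : ∃ F : D, F ≠ 0 :=
      ⟨⟨f, (Submodule.mem_dualAnnihilator f).2 fun w hw => hf' hw⟩, by
        simpa [Subtype.ext_iff] using hf⟩
    have h1 : p • F = 0 := by
      rw [← Nat.cast_smul_eq_nsmul (ZMod p), CharP.cast_eq_zero, zero_smul]
    have h2 := addOrderOf_dvd_natCard F
    rwa [addOrderOf_eq_prime h1 hF] at h2
  obtain ⟨π, hπ, hne⟩ := hP.exists_fixed_point_of_prime_dvd_card_of_fixed_point D hdvd
    (a := 0) (by
      rintro ⟨_, g, rfl⟩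
      exact Subtype.ext (LinearMap.zero_comp _))
  obtain ⟨π', hπ'⟩ := LinearMap.exists_extend π.1
  have hπB : ∀ b : B, π' b = π.1 b := fun b => LinearMap.congr_fun hπ' b
  obtain ⟨b, hb⟩ : ∃ b : B, π.1 b ≠ 0 := by
    by_contra! h
    exact hne (Subtype.ext (LinearMap.ext fun b => (h b).symm))
  refine ⟨π', fun g b hb => ?_, fun b hb => ?_, (π.1 b)⁻¹ • (b : A), B.smul_mem _ b.2, ?_⟩
  · have h1 := hπ ⟨_, g⁻¹, rfl⟩
    have h2 : (g⁻¹ • π).1 = π.1 := congrArg Subtype.val h1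
    have h3 := LinearMap.congr_fun h2 ⟨b, hb⟩
    rw [hact, inv_inv] at h3
    exact (hπB _).trans (h3.trans (hπB _).symm)
  · rw [hπB ⟨b, hlt.le hb⟩]
    exact (Submodule.mem_dualAnnihilator π.1).1 π.2 _ hb
  · rw [map_smul, hπB, smul_eq_mul, inv_mul_cancel₀ hb]

/-- A relative cocycle with values in `B` modulo `B₀` is a relative coboundary as soon as its images
under all invariant functionals are coboundaries. -/
theorem exists_sub_rawD_mem [IsTopologicalGroup Γ] [CompactSpace Γ] {m : ℕ}
    (hG : IsGPD p (m + 1) Γ) (hB : IsSmooth ρ B) (hs : ∀ g, ∀ b ∈ B₀, ρ g b ∈ B₀) (hle : B₀ ≤ B)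
    {X : (Fin (m + 2) → Γ) → A} (hX : IsCochain ρ B X) (hdX : ∀ x, rawD X x ∈ B₀)
    (h : ∀ f (hf : InvariantOn ρ B f), (∀ b ∈ B₀, f b = 0) →
      hX.map hf ∈ Coboundary Γ (ZMod p) (m + 1)) :
    ∃ w : (Fin (m + 1) → Γ) → A, IsCochain ρ B w ∧ ∀ x, X x - rawD w x ∈ B₀ := by
  induction hcard : Nat.card B using Nat.strong_induction_on generalizing B X with
  | _ N ih =>
  rcases hle.eq_or_lt with rfl | hlt
  · exact ⟨fun _ => 0, ⟨IsLocallyConstant.const 0, by simp, by simp⟩, by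
      simpa [rawD_zero] using hX.mem⟩
  have hBfin := hB.finite
  obtain ⟨π, hπ, hπ₀, b₀, hb₀, hπb⟩ := hB.exists_invariantOn hG.isProPGroup hs hlt
  let B' : Submodule (ZMod p) A := B ⊓ LinearMap.ker π
  have hB'B : B' ≤ B := inf_le_left
  have hB' : IsSmooth ρ B' := hB.mono hB'B fun g b hb =>
    ⟨hB.stable g b hb.1, (hπ g b hb.1).trans hb.2⟩
  have hB₀B' : B₀ ≤ B' := fun b hb => ⟨hle hb, hπ₀ b hb⟩
  have hcard' : Nat.card B' < N := by
    rw [← hcard]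
    refine Set.ncard_lt_ncard (s := (B' : Set A)) (t := B) ⟨hB'B, fun hBB' => ?_⟩ (Set.toFinite _)
    have : π b₀ = 0 := (hBB' hb₀).2
    rw [hπb] at this
    exact one_ne_zero this
  have hπρ : ∀ g, π (ρ g b₀) = 1 := fun g => (hπ g b₀ hb₀).trans hπb
  have hdiff : ∀ g g', ρ g b₀ - ρ g' b₀ ∈ B' := fun g g' =>
    ⟨sub_mem (hB.stable _ _ hb₀) (hB.stable _ _ hb₀), by simp [hπρ]⟩
  -- the correction by a lift of a primitive of `π ∘ X`
  obtain ⟨z₀, hz₀⟩ := h π hπ hπ₀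
  have hz₀' : ∀ x, rawD z₀.1 x = π (X x) := fun x => congrFun (congrArg Subtype.val hz₀) x
  let w₀ := fun x : Fin (m + 1) → Γ => z₀.1 x • ρ (x 0) b₀
  have hw₀ : IsCochain ρ B w₀ := IsCochain.smul hB hb₀ z₀
  have hX₁ : IsCochain ρ B' (fun x => X x - rawD w₀ x) := (hX.sub hw₀.rawD).mono fun x =>
    ⟨(hX.sub hw₀.rawD).mem x, by
      simp [w₀, rawD_smul, hz₀', hπρ]⟩
  have hdX₁ : ∀ x, rawD (fun x => X x - rawD w₀ x) x = rawD X x := fun x => by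
    rw [rawD_sub]
    simp [rawD_rawD]
  -- the invariant functionals on the smaller subspace which vanish on `B₀`
  let Λ : Submodule (ZMod p) (A →ₗ[ZMod p] ZMod p) :=
    { carrier := {f | InvariantOn ρ B' f ∧ ∀ b ∈ B₀, f b = 0}
      zero_mem' := ⟨fun _ _ _ => rfl, fun _ _ => rfl⟩
      add_mem' := fun hf hg => ⟨fun a b hb => by simp [hf.1 a b hb, hg.1 a b hb],
        fun b hb => by simp [hf.2 b hb, hg.2 b hb]⟩
      smul_mem' := fun c f hf => ⟨fun a b hb => by simp [hf.1 a b hb],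
        fun b hb => by simp [hf.2 b hb]⟩ }
  have hcc (f : Λ) : IsLocallyConstant (fun x : Fin 2 → Γ => f.1 (ρ (x 1) b₀ - ρ (x 0) b₀)) := by
    have h1 (i : Fin 2) : IsLocallyConstant fun x : Fin 2 → Γ => ρ (x i) b₀ :=
      (hB.isLocallyConstant b₀ hb₀).comp_continuous (continuous_apply i)
    exact ((h1 1).sub (h1 0)).comp f.1
  -- The obstruction to extending `f` from `B'` to an invariant functional on `B`.
  let c : Λ →+ Cocycle Γ (ZMod p) 1 := AddMonoidHom.mk'
    (fun f => ⟨⟨fun x => f.1 (ρ (x 1) b₀ - ρ (x 0) b₀), hcc f, fun g x => by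
      have h1 := f.2.1 g _ (hdiff (x 1) (x 0))
      simpa using h1⟩, by
        refine Subtype.ext (funext fun x => ?_)
        change rawD (fun x : Fin 2 → Γ => f.1 (ρ (x 1) b₀ - ρ (x 0) b₀)) x = 0
        have h3 : (fun x : Fin 2 → Γ => f.1 (ρ (x 1) b₀ - ρ (x 0) b₀)) =
            rawD (fun x : Fin 1 → Γ => f.1 (ρ (x 0) b₀)) := by
          funext x
          simp [rawD, Fin.sum_univ_succ, sub_eq_add_neg]
        rw [h3, rawD_rawD]⟩)
    (fun f g => by ext x; simp)
  let u : Λ →+ Cocycle Γ (ZMod p) (m + 1) := AddMonoidHom.mk'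
    (fun f => ⟨hX₁.map f.2.1, hX₁.map_mem_cocycle f.2.1 fun x => by
      rw [hdX₁]
      exact f.2.2 _ (hdX x)⟩)
    (fun f g => by ext x; simp [IsCochain.map])
  -- The ambient dual may be infinite, but `c f` depends only on the restriction of `f` to the
  -- finite space `B'`.
  have hfin : (Set.range c).Finite := by
    have : Finite B' := hB'.finite
    have hc : ∀ f g : Λ, (∀ b : B', f.1 b = g.1 b) → c f = c g := fun f g hfg => by
      ext x
      exact hfg ⟨_, hdiff (x 1) (x 0)⟩
    refine Set.finite_coe_iff.1 (Finite.of_injective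
      (fun y : Set.range c => fun b : B' => y.2.choose.1 b) fun y y' hyy' => Subtype.ext ?_)
    rw [← y.2.choose_spec, ← y'.2.choose_spec]
    exact hc _ _ (congrFun hyy')
  -- If the obstruction is a coboundary, it is zero, since homogeneous 0-cochains are constant. Then
  -- `f` is invariant on all of `B`, and the hypothesis on `X` applies to it.
  obtain ⟨z, hz⟩ := exists_cup_representing hG c u hfin fun f hf => by
    obtain ⟨s, hs⟩ := hf
    have hs' : ∀ x : Fin 2 → Γ, f.1 (ρ (x 1) b₀ - ρ (x 0) b₀) = 0 := fun x => by
      have h1 : rawD s.1 x = f.1 (ρ (x 1) b₀ - ρ (x 0) b₀) := congrFun (congrArg Subtype.val hs) x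
      have h2 : ∀ y : Fin 1 → Γ, s.1 y = s.1 (fun _ => 1) := fun y => by
        rw [← s.2.2 (y 0) (fun _ => 1)]
        exact congrArg s.1 (funext fun i => by rw [Subsingleton.elim i 0, mul_one])
      rw [← h1, rawD]
      simp [Fin.sum_univ_succ, h2 (fun _ => _)]
    have hfB : InvariantOn ρ B f.1 := fun g b hb => by
      have h1 : b - π b • b₀ ∈ B' := ⟨sub_mem hb (B.smul_mem _ hb₀), by simp [hπb]⟩
      have h2 := f.2.1 g _ h1
      have h3 := hs' ![1, g]
      simp only [map_sub, map_smul, Matrix.cons_val_one, Matrix.cons_val_zero, map_one,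
        Module.End.one_apply, sub_eq_zero] at h2 h3
      rw [h3] at h2
      exact sub_left_injective h2
    have h4 : hX₁.map f.2.1 = hX.map hfB - d m (hw₀.map hfB) := by
      ext x
      have h5 := congrFun (rawD_map f.1 w₀) x
      change f.1 (X x - rawD w₀ x) = f.1 (X x) - rawD (fun x => f.1 (w₀ x)) x
      rw [map_sub, h5]
    change hX₁.map f.2.1 ∈ _
    rw [h4]
    exact sub_mem (h f.1 hfB f.2.2) ⟨_, rfl⟩
  -- Its differential lies in `B'`, and applying `f` to it gives `c f ∪ z`; subtracting it makes
  -- every image a coboundary, as the induction requires.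
  let w₁ := fun x : Fin (m + 1) → Γ => z.1.1 x • ρ (x 0) b₀
  have hw₁ : IsCochain ρ B w₁ := IsCochain.smul hB hb₀ z.1
  have hdz : ∀ x, rawD z.1.1 x = 0 := fun x => congrFun (congrArg Subtype.val z.2) x
  have hdw₁ : ∀ x, rawD w₁ x = z.1.1 (fun i => x i.succ) • (ρ (x 1) b₀ - ρ (x 0) b₀) := fun x => by
    rw [rawD_smul, hdz, zero_smul, zero_add]
  have hdw₁' : IsCochain ρ B' (rawD w₁) := hw₁.rawD.mono fun x => by
    rw [hdw₁]
    exact B'.smul_mem _ (hdiff _ _)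
  obtain ⟨w₂, hw₂, hw₂'⟩ := ih _ hcard' hB' hB₀B' (hX₁.sub hdw₁') (fun x => by
    rw [rawD_sub]
    simpa [rawD_rawD, hdX₁] using hdX x) (fun f hf hf₀ => by
      have h1 := hz ⟨f, hf, hf₀⟩
      convert h1 using 1
      ext x
      change f (X x - rawD w₀ x - rawD w₁ x) = f (X x - rawD w₀ x) -
        f (ρ (x ⟨1, _⟩) b₀ - ρ (x ⟨0, _⟩) b₀) * z.1.1 (fun i => x ⟨1 + i, _⟩)
      rw [map_sub f _ (rawD w₁ x), hdw₁, map_smul, smul_eq_mul, mul_comm]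
      have h2 : (fun i : Fin (m + 1) => x i.succ) = fun i : Fin (m + 1) => x ⟨1 + i, by omega⟩ :=
        funext fun i => congrArg x (Fin.ext (add_comm (i : ℕ) 1))
      rw [h2]
      rfl) rfl
  refine ⟨fun x => w₀ x + (w₁ x + w₂ x), hw₀.add (hw₁.add (hw₂.mono fun x => hB'B (hw₂.mem x))),
    fun x => ?_⟩
  rw [rawD_add, rawD_add]
  convert hw₂' x using 1
  rw [sub_sub, sub_sub]

end Devissage

/-! ## Sums over cosets -/

section CosetSum

variable {Γ : Type*} [Group Γ]

theorem eq_of_mk_eq {A : Type*} {V : Subgroup Γ} {y : Γ → A}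
    (hy : ∀ g, ∀ v ∈ V, y (g * v) = y g) {g h : Γ}
    (hgh : (QuotientGroup.mk g : Γ ⧸ V) = QuotientGroup.mk h) : y g = y h := by
  have := hy g _ (QuotientGroup.eq.1 hgh)
  rw [mul_inv_cancel_left] at this
  exact this.symm

theorem apply_out_mk {A : Type*} {V : Subgroup Γ} {y : Γ → A}
    (hy : ∀ g, ∀ v ∈ V, y (g * v) = y g) (g : Γ) :
    y (Quotient.out (QuotientGroup.mk g : Γ ⧸ V)) = y g :=
  eq_of_mk_eq hy (Quotient.out_eq' _)

variable {A : Type*} [AddCommGroup A]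

open Classical in
/-- The sum of the values of `y` at the chosen representatives of the left cosets of `V`. -/
noncomputable def cosetSum (V : Subgroup Γ) [Finite (Γ ⧸ V)] (y : Γ → A) : A :=
  letI : Fintype (Γ ⧸ V) := Fintype.ofFinite _
  ∑ c : Γ ⧸ V, y (Quotient.out c)

variable {V W : Subgroup Γ} [Finite (Γ ⧸ V)] [Finite (Γ ⧸ W)]

theorem cosetSum_mul_left {y : Γ → A} (hy : ∀ g, ∀ v ∈ V, y (g * v) = y g) (h : Γ) :
    cosetSum V (fun g => y (h * g)) = cosetSum V y := by
  classical
  let _ : Fintype (Γ ⧸ V) := Fintype.ofFinite _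
  refine Fintype.sum_equiv (MulAction.toPerm h) _ _ fun c => ?_
  refine eq_of_mk_eq hy ?_
  rw [MulAction.toPerm_apply]
  conv_rhs => rw [← Quotient.out_eq' c]
  exact (Quotient.out_eq' _).symm

/-- Summation in stages. -/
theorem cosetSum_cosetSum {D : Type*} [Fintype D] (δ : D → Γ) (hWV : W ≤ V) (hδ : ∀ d, δ d ∈ V)
    (hinj : ∀ d d', (δ d)⁻¹ * δ d' ∈ W → d = d') (hsurj : ∀ v ∈ V, ∃ d, (δ d)⁻¹ * v ∈ W)
    {y : Γ → A} (hy : ∀ g, ∀ v ∈ W, y (g * v) = y g) :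
    cosetSum V (fun g => ∑ d, y (g * δ d)) = cosetSum W y := by
  classical
  let _ : Fintype (Γ ⧸ V) := Fintype.ofFinite _
  let _ : Fintype (Γ ⧸ W) := Fintype.ofFinite _
  change ∑ c : Γ ⧸ V, ∑ d, y (Quotient.out c * δ d) = ∑ c : Γ ⧸ W, y (Quotient.out c)
  rw [← Fintype.sum_prod_type' (f := fun (c : Γ ⧸ V) d => y (Quotient.out c * δ d))]
  refine Fintype.sum_bijective
    (fun q : (Γ ⧸ V) × D => (QuotientGroup.mk (Quotient.out q.1 * δ q.2) : Γ ⧸ W)) ⟨?_, ?_⟩ _ _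
    fun q => (apply_out_mk hy _).symm
  · rintro ⟨c, d⟩ ⟨c', d'⟩ hcd
    have h1 := QuotientGroup.eq.1 hcd
    have h2 : c = c' := by
      have h3 : (QuotientGroup.mk (Quotient.out c) : Γ ⧸ V) =
          QuotientGroup.mk (Quotient.out c') := by
        rw [QuotientGroup.eq]
        have := mul_mem (mul_mem (hδ d) (hWV h1)) (inv_mem (hδ d'))
        simpa [mul_assoc] using this
      exact (Quotient.out_eq' c).symm.trans (h3.trans (Quotient.out_eq' c'))
    subst h2
    exact Prod.ext rfl (hinj d d' (by simpa [mul_assoc] using h1))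
  · intro e
    obtain ⟨g, rfl⟩ := QuotientGroup.mk_surjective e
    have h1 : (Quotient.out (QuotientGroup.mk g : Γ ⧸ V))⁻¹ * g ∈ V :=
      QuotientGroup.eq.1 (Quotient.out_eq' _)
    obtain ⟨d, hd⟩ := hsurj _ h1
    refine ⟨(QuotientGroup.mk g, d), QuotientGroup.eq.2 ?_⟩
    simpa [mul_assoc] using hd

/-- Each coset of `V` splits into that many cosets of `W`, on which `y` is constant. Modulo `p` the
sum over the finer cosets therefore vanishes when the index is divisible by `p`. -/
theorem cosetSum_of_le (hWV : W ≤ V) {y : Γ → A} (hy : ∀ g, ∀ v ∈ V, y (g * v) = y g) :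
    cosetSum W y = W.relIndex V • cosetSum V y := by
  classical
  have : W.FiniteIndex := W.finiteIndex_of_finite_quotient
  let _ : Fintype (V ⧸ W.subgroupOf V) := Fintype.ofFinite _
  have key := cosetSum_cosetSum (D := V ⧸ W.subgroupOf V) (fun d => ((Quotient.out d : V) : Γ)) hWV
    (fun d => (Quotient.out d).2) (fun d d' h => ?_) (fun v hv => ?_)
    (fun g v hv => hy g v (hWV hv))
  · rw [← key]
    simp only [hy _ _ (Subtype.prop _), Finset.sum_const, Finset.card_univ, cosetSum,
      Finset.smul_sum]
    rw [← Nat.card_eq_fintype_card]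
    rfl
  · rw [← Quotient.out_eq' d, ← Quotient.out_eq' d']
    exact QuotientGroup.eq.2 h
  · have h := QuotientGroup.eq.1 (Quotient.out_eq'
      (QuotientGroup.mk (⟨v, hv⟩ : V) : V ⧸ W.subgroupOf V))
    exact ⟨_, Subgroup.mem_subgroupOf.1 h⟩

theorem rawD_cosetSum (V : Subgroup Γ) [Finite (Γ ⧸ V)] {n : ℕ} (ψ : (Fin n → Γ) → A) :
    rawD (fun x => cosetSum V fun g => ψ (fun i => g⁻¹ * x i)) =
      fun x => cosetSum V fun g => rawD ψ (fun i => g⁻¹ * x i) :=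
  rawD_sum _ _

end CosetSum

/-! ## The translation action on functions -/

section Translation

variable {k Γ : Type*} [Field k] [Group Γ]

variable (k Γ) in
/-- The action of `Γ` on functions by left translation. -/
def translation : Representation k Γ (Γ → k) where
  toFun g := LinearMap.funLeft k k (fun h => g⁻¹ * h)
  map_one' := by ext; simp [LinearMap.funLeft]
  map_mul' g g' := by ext; simp [LinearMap.funLeft, mul_assoc]

@[simp]
theorem translation_apply (g : Γ) (y : Γ → k) (h : Γ) : translation k Γ g y h = y (g⁻¹ * h) := rfl

variable (k) in
/-- The functions which are invariant under right translation by `V`. -/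
def rightInvariant (V : Subgroup Γ) : Submodule k (Γ → k) where
  carrier := {y | ∀ g, ∀ v ∈ V, y (g * v) = y g}
  zero_mem' := fun _ _ _ => rfl
  add_mem' := fun ha hb g v hv => by simp [ha g v hv, hb g v hv]
  smul_mem' := fun c a ha g v hv => by simp [ha g v hv]

theorem rightInvariant_mono {V W : Subgroup Γ} (h : W ≤ V) :
    rightInvariant k V ≤ rightInvariant k W := fun _ hy g v hv => hy g v (h hv)

theorem translation_mem_rightInvariant {V : Subgroup Γ} (g : Γ) {y : Γ → k}
    (hy : y ∈ rightInvariant k V) : translation k Γ g y ∈ rightInvariant k V := fun h v hv => by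
  simp [← mul_assoc, hy _ v hv]

variable (k) in
/-- The sum over the cosets of `V` as a linear functional. -/
noncomputable def cosetSumₗ (V : Subgroup Γ) [Finite (Γ ⧸ V)] : (Γ → k) →ₗ[k] k where
  toFun := cosetSum V
  map_add' x y := by simp [cosetSum, Finset.sum_add_distrib]
  map_smul' c x := by simp [cosetSum, Finset.mul_sum]

variable (k) in
open Classical in
/-- The indicator function of `V`. -/
noncomputable def indicator (V : Subgroup Γ) : Γ → k := fun g => if g ∈ V then 1 else 0

theorem indicator_mem (V : Subgroup Γ) : indicator k V ∈ rightInvariant k V := fun g v hv => by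
  have h := V.mul_mem_cancel_right (y := g) hv
  by_cases hg : g ∈ V <;> simp [indicator, h, hg]

variable {V W : Subgroup Γ} [Finite (Γ ⧸ V)] [Finite (Γ ⧸ W)]

theorem invariantOn_cosetSumₗ : InvariantOn (translation k Γ) (rightInvariant k V)
    (cosetSumₗ k V) := fun g _ hy => cosetSum_mul_left hy g⁻¹

open Classical in
theorem eq_sum_indicator {y : Γ → k} (hy : y ∈ rightInvariant k V) :
    letI : Fintype (Γ ⧸ V) := Fintype.ofFinite _
    y = ∑ c : Γ ⧸ V, y (Quotient.out c) • translation k Γ (Quotient.out c) (indicator k V) := by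
  funext g
  simp only [Finset.sum_apply, Pi.smul_apply, translation_apply, smul_eq_mul]
  rw [Finset.sum_eq_single (QuotientGroup.mk g)]
  · have h1 : (Quotient.out (QuotientGroup.mk g : Γ ⧸ V))⁻¹ * g ∈ V :=
      QuotientGroup.eq.1 (Quotient.out_eq' _)
    rw [apply_out_mk hy, indicator, if_pos h1, mul_one]
  · intro c _ hc
    rw [indicator, if_neg, mul_zero]
    intro h
    exact hc ((Quotient.out_eq' c).symm.trans (QuotientGroup.eq.2 h))
  · simp

theorem cosetSum_indicator : cosetSum V (indicator k V) = 1 := by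
  classical
  rw [cosetSum, Finset.sum_eq_single (QuotientGroup.mk 1)]
  · rw [apply_out_mk (indicator_mem V)]
    simp [indicator]
  · intro c _ hc
    rw [indicator, if_neg]
    intro h
    refine hc ((Quotient.out_eq' c).symm.trans (QuotientGroup.eq.2 ?_))
    simpa using h
  · simp

/-- The translates of the indicator of `V` span, and an invariant functional takes one value on all
of them; so the sum is the only invariant functional up to scalars. -/
theorem InvariantOn.eq_cosetSum {f : (Γ → k) →ₗ[k] k}
    (hf : InvariantOn (translation k Γ) (rightInvariant k V) f) {y : Γ → k}
    (hy : y ∈ rightInvariant k V) : f y = f (indicator k V) * cosetSum V y := by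
  classical
  let _ : Fintype (Γ ⧸ V) := Fintype.ofFinite _
  conv_lhs => rw [eq_sum_indicator hy]
  simp only [map_sum, map_smul, hf _ _ (indicator_mem V), cosetSum, Finset.mul_sum, smul_eq_mul]
  exact Finset.sum_congr rfl fun c _ => mul_comm _ _

/-- Pointwise local constancy suffices because finitely many coset representatives determine the
function. -/
theorem isLocallyConstant_of_rightInvariant {Z : Type*} [TopologicalSpace Z]
    {F : Z → Γ → k} (hF : ∀ x, F x ∈ rightInvariant k V)
    (h : ∀ g, IsLocallyConstant fun x => F x g) : IsLocallyConstant F := by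
  refine (IsLocallyConstant.iff_eventually_eq F).2 fun x => ?_
  have h1 : ∀ᶠ y in nhds x, ∀ c : Γ ⧸ V, F y (Quotient.out c) = F x (Quotient.out c) :=
    Filter.eventually_all.2 fun c => (IsLocallyConstant.iff_eventually_eq _).1 (h _) x
  filter_upwards [h1] with y hy
  funext g
  rw [← apply_out_mk (hF y) g, ← apply_out_mk (hF x) g, hy]

theorem isSmooth_rightInvariant [Finite k] [TopologicalSpace Γ] [IsTopologicalGroup Γ]
    [CompactSpace Γ] (hV : IsOpen (V : Set Γ)) :
    IsSmooth (translation k Γ) (rightInvariant k V) := by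
  refine ⟨?_, fun g y hy => translation_mem_rightInvariant g hy, fun y hy => ?_⟩
  · refine Finite.of_injective
      (fun (y : rightInvariant k V) (c : Γ ⧸ V) => y.1 (Quotient.out c)) fun y y' h => ?_
    refine Subtype.ext (funext fun g => ?_)
    rw [← apply_out_mk y.2 g, ← apply_out_mk y'.2 g]
    exact congrFun h _
  · obtain ⟨N, hN⟩ := IsTopologicalGroup.exist_openNormalSubgroup_sub_clopen_nhds_of_one
      (W := (V : Set Γ)) ⟨V.isClosed_of_isOpen hV, hV⟩ V.one_mem
    refine (IsLocallyConstant.iff_exists_open _).2 fun g => ⟨(fun h => g⁻¹ * h) ⁻¹' (N : Set Γ),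
      N.toOpenSubgroup.isOpen.preimage (by fun_prop), by simp, fun h hh => ?_⟩
    funext x
    have h1 : (g⁻¹ * h)⁻¹ ∈ (N : Subgroup Γ) := inv_mem hh
    have h2 := N.isNormal'.conj_mem _ h1 (g⁻¹ * x)⁻¹
    have h3 := hy (g⁻¹ * x) _ (hN h2)
    simpa [mul_assoc] using h3

end Translation

/-! ### Lifting cocycles in the top degree and vanishing one degree above -/

section ProP

variable {p : ℕ} {Γ : Type*} [Group Γ] [TopologicalSpace Γ] [IsTopologicalGroup Γ]
  [CompactSpace Γ]

/-- This is where infiniteness of Γ matters: an open subgroup cannot be trivial, and removing a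
nontrivial element leaves a neighbourhood of 1 containing a smaller open subgroup. -/
theorem exists_isOpen_lt (hΓ : IsProPGroup p Γ) [Infinite Γ] {V : Subgroup Γ}
    (hV : IsOpen (V : Set Γ)) : ∃ W : Subgroup Γ, IsOpen (W : Set Γ) ∧ W < V := by
  have := hΓ.t2Space
  have := hΓ.totallyDisconnectedSpace
  have hfin : Finite (Γ ⧸ V) := Subgroup.quotient_finite_of_isOpen V hV
  obtain ⟨v, hvV, hv⟩ : ∃ v ∈ V, v ≠ 1 := by
    by_contra! h
    have hbot : V = ⊥ := (Subgroup.eq_bot_iff_forall V).2 h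
    subst hbot
    exact not_finite_iff_infinite.2 ‹Infinite Γ›
      (Finite.of_equiv _ (QuotientGroup.quotientBot (G := Γ)).toEquiv)
  obtain ⟨N, hN⟩ := ProfiniteGrp.exist_openNormalSubgroup_sub_open_nhds_of_one
    (U := (V : Set Γ) ∩ {v}ᶜ) (hV.inter isOpen_compl_singleton) ⟨V.one_mem, hv.symm⟩
  refine ⟨N, N.toOpenSubgroup.isOpen, lt_of_le_of_ne (fun g hg => (hN hg).1) ?_⟩
  rintro rfl
  exact (hN hvV).2 rfl

variable [Fact p.Prime]

theorem prime_dvd_relIndex (hΓ : IsProPGroup p Γ) {V W : Subgroup Γ}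
    (hW : IsOpen (W : Set Γ)) (h : W < V) : p ∣ W.relIndex V := by
  obtain ⟨N, hN⟩ := IsTopologicalGroup.exist_openNormalSubgroup_sub_clopen_nhds_of_one
    (W := (W : Set Γ)) ⟨W.isClosed_of_isOpen hW, hW⟩ W.one_mem
  obtain ⟨j, hj⟩ := hΓ.exists_index_eq N
  have h1 : W.relIndex V ∣ p ^ j := by
    rw [← hj]
    exact (Dvd.intro _ (Subgroup.relIndex_mul_index h.le)).trans (Subgroup.index_dvd_of_le hN)
  obtain ⟨i, -, hi⟩ := (Nat.dvd_prime_pow Fact.out).1 h1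
  rw [hi]
  refine dvd_pow_self p fun h0 => ?_
  rw [h0, pow_zero, Subgroup.relIndex_eq_one] at hi
  exact h.not_ge hi

/-- Cocycles with values in `𝔽_p` lift along the sum map from functions on the cosets of an open
subgroup. -/
theorem exists_isCochain_cosetSum_eq {m : ℕ} (hG : IsGPD p (m + 1) Γ) {V : Subgroup Γ}
    [Finite (Γ ⧸ V)] (hV : IsOpen (V : Set Γ)) {t : Cochain Γ (ZMod p) (m + 1)}
    (ht : t ∈ Cocycle Γ (ZMod p) (m + 1)) :
    ∃ X : (Fin (m + 2) → Γ) → Γ → ZMod p,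
      IsCochain (translation (ZMod p) Γ) (rightInvariant (ZMod p) V) X ∧
      (∀ x, rawD X x = 0) ∧ ∀ x, cosetSum V (X x) = t.1 x := by
  have := hG.infinite
  obtain ⟨W, hW, hWV⟩ := exists_isOpen_lt hG.isProPGroup hV
  have hfin : Finite (Γ ⧸ W) := Subgroup.quotient_finite_of_isOpen W hW
  have hsm := isSmooth_rightInvariant (k := ZMod p) hV
  have hle := rightInvariant_mono (k := ZMod p) hWV.le
  let S : Submodule (ZMod p) (Γ → ZMod p) :=
    rightInvariant (ZMod p) V ⊓ LinearMap.ker (cosetSumₗ (ZMod p) V)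
  -- A lift of `t` which is usually not closed; its differential has sum zero, so it is closed
  -- modulo `S`.
  let T : (Fin (m + 2) → Γ) → Γ → ZMod p :=
    fun x => t.1 x • translation (ZMod p) Γ (x 0) (indicator (ZMod p) V)
  have hT : IsCochain (translation (ZMod p) Γ) (rightInvariant (ZMod p) V) T :=
    IsCochain.smul hsm (indicator_mem V) t
  have hσ : ∀ g, cosetSumₗ (ZMod p) V (translation (ZMod p) Γ g (indicator (ZMod p) V)) = 1 :=
    fun g => (invariantOn_cosetSumₗ g _ (indicator_mem V)).trans cosetSum_indicator
  have hdt : ∀ x, rawD t.1 x = 0 := fun x => congrFun (congrArg Subtype.val ht) x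
  -- Duality is applied in the larger module of functions on the cosets of `W`. There each invariant
  -- functional is a multiple of the sum over `W`, which kills the values of `T`.
  obtain ⟨w, hw, hwT⟩ := exists_sub_rawD_mem (B₀ := S) hG
    (isSmooth_rightInvariant (k := ZMod p) hW)
    (fun g y hy => ⟨translation_mem_rightInvariant g hy.1,
      (invariantOn_cosetSumₗ g y hy.1).trans hy.2⟩)
    (inf_le_left.trans hle) (hT.mono fun x => hle (hT.mem x))
    (fun x => by
      rw [rawD_smul, hdt, zero_smul, zero_add]
      refine S.smul_mem _ ⟨sub_mem (hsm.stable _ _ (indicator_mem V))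
        (hsm.stable _ _ (indicator_mem V)), ?_⟩
      exact (map_sub _ _ _).trans (by rw [hσ, hσ, sub_self]))
    (fun f hf _ => by
      refine (congrArg (· ∈ Coboundary Γ (ZMod p) (m + 1)) ?_).mpr (zero_mem _)
      ext x
      change f (T x) = 0
      rw [hf.eq_cosetSum (hle (hT.mem x)), cosetSum_of_le hWV.le (hT.mem x),
        ← Nat.cast_smul_eq_nsmul (ZMod p),
        (ZMod.natCast_eq_zero_iff _ _).2 (prime_dvd_relIndex hG.isProPGroup hW hWV), zero_smul,
        mul_zero])
  -- Although `w` is only invariant under `W`, its differential differs from `T` by elements of `S`,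
  -- hence is invariant under `V`. It is the closed lift sought.
  have hmem : ∀ x, rawD w x ∈ rightInvariant (ZMod p) V := fun x => by
    have := sub_mem (hT.mem x) (hwT x).1
    rwa [sub_sub_cancel] at this
  refine ⟨rawD w, hw.rawD.mono hmem, rawD_rawD w, fun x => ?_⟩
  have h1 : cosetSumₗ (ZMod p) V (T x - rawD w x) = 0 := (hwT x).2
  rw [map_sub, sub_eq_zero] at h1
  refine h1.symm.trans ?_
  simp [T, hσ]

/-- In the top degree, cocycles with values in `𝔽_p` lift along invariant functionals. -/
theorem IsSmooth.exists_lift_cocycle {A : Type*} [AddCommGroup A] [Module (ZMod p) A]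
    {ρ : Representation (ZMod p) Γ A} {B : Submodule (ZMod p) A} {m : ℕ}
    (hG : IsGPD p (m + 1) Γ) (hB : IsSmooth ρ B) {π : A →ₗ[ZMod p] ZMod p}
    (hπ : InvariantOn ρ B π) {b : A} (hb : b ∈ B) (hπb : π b = 1)
    {t : Cochain Γ (ZMod p) (m + 1)} (ht : t ∈ Cocycle Γ (ZMod p) (m + 1)) :
    ∃ X : (Fin (m + 2) → Γ) → A, IsCochain ρ B X ∧ (∀ x, rawD X x = 0) ∧ ∀ x, π (X x) = t.1 x := by
  classical
  obtain ⟨N, hN⟩ := hB.exists_openNormalSubgroup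
  have hNo : IsOpen ((N : Subgroup Γ) : Set Γ) := N.toOpenSubgroup.isOpen
  have hfin : Finite (Γ ⧸ (N : Subgroup Γ)) := Subgroup.quotient_finite_of_isOpen _ hNo
  obtain ⟨X, hX, hdX, hXt⟩ := exists_isCochain_cosetSum_eq hG hNo ht
  -- On functions invariant under `N` this is the equivariant map sending the indicator of `N` to
  -- `b`, and `π` composed with it is the sum over cosets. A closed lift to functions thus maps to
  -- one with values in `B`.
  let L : (Γ → ZMod p) →+ A := AddMonoidHom.mk'
    (fun y => cosetSum (N : Subgroup Γ) (fun g => y g • ρ g b))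
    (fun y z => by simp [cosetSum, add_smul, Finset.sum_add_distrib])
  refine ⟨fun x => L (X x), ⟨hX.1.comp L, fun g x => ?_, fun x => ?_⟩, fun x => ?_, fun x => ?_⟩
  · have hinv : ∀ h, ∀ v ∈ (N : Subgroup Γ), X x (h * v) • ρ (g * (h * v)) b =
        X x h • ρ (g * h) b := fun h v hv => by
      rw [hX.mem x h v hv, ← mul_assoc, map_mul ρ (g * h) v, Module.End.mul_apply, hN v hv b hb]
    have h1 := cosetSum_mul_left (V := (N : Subgroup Γ)) (A := A)
      (y := fun h => X x h • ρ (g * h) b) hinv g⁻¹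
    rw [hX.map_mul]
    simp only [mul_inv_cancel_left] at h1
    refine h1.trans ?_
    simp only [L, AddMonoidHom.mk'_apply, cosetSum, map_sum, map_smul, map_mul,
      Module.End.mul_apply]
  · exact sum_mem fun c _ => B.smul_mem _ (hB.stable _ _ hb)
  · rw [rawD_map L X]
    simp [hdX]
  · rw [← hXt]
    simp only [L, AddMonoidHom.mk'_apply, cosetSum, map_sum, map_smul, hπ _ _ hb, hπb, smul_eq_mul,
      mul_one]

/-- A cochain whose differential has values in a smaller subspace can be corrected by a cocycle to
have values in that subspace. -/
theorem IsSmooth.exists_rawD_eq_of_le {A : Type*} [AddCommGroup A] [Module (ZMod p) A]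
    {ρ : Representation (ZMod p) Γ A} {B B₁ : Submodule (ZMod p) A} {m : ℕ}
    (hG : IsGPD p (m + 1) Γ) (hB : IsSmooth ρ B) (hs : ∀ g, ∀ b ∈ B₁, ρ g b ∈ B₁) (hle : B₁ ≤ B)
    {w : (Fin (m + 2) → Γ) → A} (hw : IsCochain ρ B w) (hdw : ∀ x, rawD w x ∈ B₁) :
    ∃ w' : (Fin (m + 2) → Γ) → A, IsCochain ρ B₁ w' ∧ rawD w' = rawD w := by
  induction hcard : Nat.card B using Nat.strong_induction_on generalizing B w with
  | _ N ih =>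
  rcases hle.eq_or_lt with rfl | hlt
  · exact ⟨w, hw, rfl⟩
  have hBfin := hB.finite
  obtain ⟨π, hπ, hπ₁, b, hb, hπb⟩ := hB.exists_invariantOn hG.isProPGroup hs hlt
  let B' : Submodule (ZMod p) A := B ⊓ LinearMap.ker π
  have hB' : IsSmooth ρ B' := hB.mono inf_le_left fun g b hb =>
    ⟨hB.stable g b hb.1, (hπ g b hb.1).trans hb.2⟩
  have hcard' : Nat.card B' < N := by
    rw [← hcard]
    refine Set.ncard_lt_ncard (s := (B' : Set A)) (t := B) ⟨inf_le_left, fun hBB' => ?_⟩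
      (Set.toFinite _)
    have : π b = 0 := (hBB' hb).2
    rw [hπb] at this
    exact one_ne_zero this
  -- Since `π` kills `B₁`, the cochain `π ∘ w` is closed. Subtracting a closed lift pushes `w` into
  -- the kernel of `π` without changing its differential.
  obtain ⟨X, hX, hdX, hXπ⟩ := hB.exists_lift_cocycle hG hπ hb hπb
    (hw.map_mem_cocycle hπ fun x => hπ₁ _ (hdw x))
  have hd : rawD (fun x => w x - X x) = rawD w := by
    funext x
    rw [rawD_sub]
    simp [hdX]
  obtain ⟨w', hw', hdw'⟩ := ih _ hcard' hB' (fun b hb => ⟨hle hb, hπ₁ b hb⟩)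
    ((hw.sub hX).mono fun x => ⟨(hw.sub hX).mem x, by
      exact (map_sub π _ _).trans (by rw [hXπ]; exact sub_self _)⟩)
    (by simpa only [hd] using hdw) rfl
  exact ⟨w', hw', hdw'.trans hd⟩

/-- Cocycles in one degree above the top one, with values in the functions on the cosets of an open
subgroup, are coboundaries. -/
theorem exists_rawD_eq_of_rightInvariant {m : ℕ} (hG : IsGPD p (m + 1) Γ) {V : Subgroup Γ}
    (hV : IsOpen (V : Set Γ)) {X : (Fin (m + 3) → Γ) → Γ → ZMod p}
    (hX : IsCochain (translation (ZMod p) Γ) (rightInvariant (ZMod p) V) X)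
    (hdX : ∀ x, rawD X x = 0) :
    ∃ w : (Fin (m + 2) → Γ) → Γ → ZMod p,
      IsCochain (translation (ZMod p) Γ) (rightInvariant (ZMod p) V) w ∧ rawD w = X := by
  -- Chosen so that the contraction `w` below is right invariant under it.
  let W : Subgroup Γ :=
    { carrier := {v | v ∈ V ∧ ∀ g (y : Fin (m + 2) → Γ),
        X (Fin.cons (g * v) y) = X (Fin.cons g y)}
      one_mem' := ⟨V.one_mem, by simp⟩
      mul_mem' := fun ha hb => ⟨V.mul_mem ha.1 hb.1, fun g y => by
        rw [← mul_assoc, hb.2, ha.2]⟩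
      inv_mem' := fun {a} ha => ⟨V.inv_mem ha.1, fun g y => by
        rw [← ha.2 (g * a⁻¹), inv_mul_cancel_right]⟩ }
  -- By compactness of Γ and its powers: the bad elements are the projection of a closed set along a
  -- compact factor.
  have hWo : IsOpen (W : Set Γ) := by
    let C : Set ((Γ × (Fin (m + 2) → Γ)) × Γ) :=
      {q | X (Fin.cons (q.1.1 * q.2) q.1.2) = X (Fin.cons q.1.1 q.1.2)}
    have hC : IsOpen C := by
      have h1 : IsLocallyConstant fun q : (Γ × (Fin (m + 2) → Γ)) × Γ =>
          X (Fin.cons (q.1.1 * q.2) q.1.2) :=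
        hX.1.comp_continuous (continuous_cons (a := fun q : (Γ × (Fin (m + 2) → Γ)) × Γ =>
          q.1.1 * q.2) (g := fun q => q.1.2) (by fun_prop) (by fun_prop))
      have h2 : IsLocallyConstant fun q : (Γ × (Fin (m + 2) → Γ)) × Γ =>
          X (Fin.cons q.1.1 q.1.2) :=
        hX.1.comp_continuous (continuous_cons (a := fun q : (Γ × (Fin (m + 2) → Γ)) × Γ =>
          q.1.1) (g := fun q => q.1.2) (by fun_prop) (by fun_prop))
      have h3 := (h1.sub h2).isOpen_fiber 0
      simpa only [Pi.sub_apply, sub_eq_zero] using h3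
    have h4 : (W : Set Γ) = (V : Set Γ) ∩ (Prod.snd '' Cᶜ)ᶜ := by
      ext v
      refine and_congr Iff.rfl ⟨fun h => ?_, fun h g y => ?_⟩
      · rintro ⟨⟨q, v⟩, hq, rfl⟩
        exact hq (h q.1 q.2)
      · by_contra hne
        exact h ⟨((g, y), v), hne, rfl⟩
    rw [h4]
    exact hV.inter (isClosedMap_snd_of_compactSpace _ hC.isClosed_compl).isOpen_compl
  have hWV : W ≤ V := fun v hv => hv.1
  have hfin : Finite (Γ ⧸ W) := Subgroup.quotient_finite_of_isOpen W hWo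
  -- Contracting at a fixed point is not equivariant; contracting the coordinate at `g` by `g`
  -- itself is. The price is invariance under `W` only.
  let w : (Fin (m + 2) → Γ) → Γ → ZMod p := fun x g => X (Fin.cons g x) g
  have hwmem : ∀ x, w x ∈ rightInvariant (ZMod p) W := fun x g v hv => by
    simp only [w]
    rw [hv.2, hX.mem _ g v hv.1]
  have hw : IsCochain (translation (ZMod p) Γ) (rightInvariant (ZMod p) W) w := by
    refine ⟨isLocallyConstant_of_rightInvariant hwmem fun g => ?_, fun g x => ?_, hwmem⟩
    · exact (hX.1.comp_continuous (continuous_cons (a := fun _ : Fin (m + 2) → Γ => g)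
        (g := fun x => x) (by fun_prop) (by fun_prop))).comp fun y : Γ → ZMod p => y g
    · funext h
      have h1 : (Fin.cons h (fun i => g * x i) : Fin (m + 3) → Γ) =
          fun i => g * (Fin.cons (g⁻¹ * h) x : Fin (m + 3) → Γ) i := by
        funext i
        refine Fin.cases ?_ (fun i => ?_) i <;> simp
      simp only [w, translation_apply]
      rw [h1, hX.map_mul, translation_apply]
  have hdw : rawD w = X := by
    funext x g
    have h1 := rawD_cons X g x
    rw [hdX] at h1
    have h2 := rawD_map (Pi.evalAddMonoidHom (fun _ : Γ => ZMod p) g) w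
    have h3 := rawD_map (Pi.evalAddMonoidHom (fun _ : Γ => ZMod p) g) fun y => X (Fin.cons g y)
    have h4 : rawD w x g = rawD (fun y => X (Fin.cons g y)) x g :=
      (congrFun h2 x).symm.trans (congrFun h3 x)
    rw [h4, ← sub_eq_zero.1 h1.symm]
  -- The primitive over `W` is corrected by a cocycle to have values invariant under `V`.
  obtain ⟨w', hw', hdw'⟩ := (isSmooth_rightInvariant (k := ZMod p) hWo).exists_rawD_eq_of_le hG
    (fun g y hy => translation_mem_rightInvariant g hy) (rightInvariant_mono hWV) hw
    (fun x => by rw [hdw]; exact hX.mem x)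
  exact ⟨w', hw', hdw'.trans hdw⟩

end ProP

/-! ## Norms and corestriction -/

theorem retract_mul' {G : Type*} [Group G] [TopologicalSpace G] {U V : Subgroup G} (h : V ≤ U)
    {v : U} (hv : v ∈ V.subgroupOf U) (u : U) :
    retract h (v * u) = ⟨v, hv⟩ * retract h u :=
  retract_mul h ⟨v, hv⟩ u

section Norm

variable {Γ A : Type*} [Group Γ] [TopologicalSpace Γ] [IsTopologicalGroup Γ] [AddCommGroup A]

/-- The norm of a cochain which is invariant under `V`. -/
noncomputable def normCochain (V : Subgroup Γ) [Finite (Γ ⧸ V)] {n : ℕ}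
    (ψ : (Fin (n + 1) → Γ) → A) (hψ : IsLocallyConstant ψ)
    (hV : ∀ v ∈ V, ∀ x : Fin (n + 1) → Γ, ψ (fun i => v * x i) = ψ x) : Cochain Γ A n :=
  ⟨fun x => cosetSum V fun g => ψ (fun i => g⁻¹ * x i), by
    refine ⟨?_, fun h x => ?_⟩
    · exact isLocallyConstant_sum _ _ fun c _ => hψ.comp_continuous
        (f := fun x : Fin (n + 1) → Γ => fun i => (Quotient.out c)⁻¹ * x i) (by fun_prop)
    · have h1 := cosetSum_mul_left (V := V) (y := fun g => ψ (fun i => g⁻¹ * x i))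
        (fun g v hv => by
          rw [← hV v⁻¹ (inv_mem hv) (fun i => g⁻¹ * x i)]
          simp [mul_assoc]) h⁻¹
      refine Eq.trans ?_ h1
      simp [mul_assoc]⟩

/-- Norms of pullbacks of a cocycle along two equivariant maps are cohomologous. -/
theorem normCochain_sub_mem_coboundary (V : Subgroup Γ) [Finite (Γ ⧸ V)] {Ω : Type*}
    [TopologicalSpace Ω] {n : ℕ} {φ : (Fin (n + 2) → Ω) → A} (hφ : IsLocallyConstant φ)
    (hdφ : ∀ x, rawD φ x = 0) {r s : Γ → Ω} (hr : Continuous r) (hs : Continuous s)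
    (a : Γ → Ω → Ω) (har : ∀ v ∈ V, ∀ g, r (v * g) = a v (r g))
    (has : ∀ v ∈ V, ∀ g, s (v * g) = a v (s g))
    (haφ : ∀ v ∈ V, ∀ x, φ (fun i => a v (x i)) = φ x) {f g : Cochain Γ A (n + 1)}
    (hf : ∀ x, f.1 x = cosetSum V fun g => φ fun i => r (g⁻¹ * x i))
    (hg : ∀ x, g.1 x = cosetSum V fun g => φ fun i => s (g⁻¹ * x i)) :
    f - g ∈ Coboundary Γ A (n + 1) := by
  -- The primitive is the norm of the prism homotopy, which is invariant under `V` because `r` and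
  -- `s` intertwine the same action.
  refine ⟨normCochain V (prism r s (n + 1) φ) (isLocallyConstant_prism hr hs hφ)
    fun v hv x => ?_, Subtype.ext (funext fun x => ?_)⟩
  · rw [prism_comp]
    simp only [har v hv, has v hv]
    rw [prism_comp_left]
    simp only [haφ v hv]
  · change rawD (fun x => cosetSum V fun g => prism r s (n + 1) φ (fun i => g⁻¹ * x i)) x =
      f.1 x - g.1 x
    have hdφ' : rawD φ = fun _ => 0 := funext hdφ
    rw [rawD_cosetSum, hf, hg]
    simp only [cosetSum]
    rw [← Finset.sum_sub_distrib]
    refine Finset.sum_congr rfl fun c _ => ?_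
    have h1 := rawD_prism r s φ (fun i => (Quotient.out c)⁻¹ * x i)
    rwa [hdφ', prism_zero, add_zero] at h1

end Norm

section Cor

variable {G : Type*} [Group G] [TopologicalSpace G] [IsTopologicalGroup G] [CompactSpace G]
  {A : Type*} [AddCommGroup A] {T U V : Subgroup G}

theorem corCochain_apply [Finite (U ⧸ V.subgroupOf U)] (h : V ≤ U) (hV : IsOpen (V : Set G))
    {n : ℕ} (f : Cochain V A n) (x : Fin (n + 1) → U) :
    (corCochain h hV n f).1 x =
      cosetSum (V.subgroupOf U) fun g => f.1 fun i => retract h (g⁻¹ * x i) := rfl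

theorem cor_mk (h : V ≤ U) (hV : IsOpen (V : Set G)) {n : ℕ} (f : Cocycle V A n) :
    ∃ hf, cor h hV n (QuotientAddGroup.mk f) =
      (QuotientAddGroup.mk (⟨corCochain h hV n f.1, hf⟩ : Cocycle U A n) : H U A n) :=
  ⟨_, rfl⟩

theorem rawD_eq_zero {Γ : Type*} [Group Γ] [TopologicalSpace Γ] {n : ℕ} {f : Cochain Γ A n}
    (hf : f ∈ Cocycle Γ A n) (x : Fin (n + 2) → Γ) : rawD f.1 x = 0 :=
  congrFun (congrArg Subtype.val hf) x

/-- Summing in stages turns the iterated corestriction into a norm over `V` along the composite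
retraction. This need not be the chosen retraction from `T` to `V`, hence equality only up to a
coboundary. -/
theorem corCochain_corCochain_sub_mem (hVU : V ≤ U) (hUT : U ≤ T) (hV : IsOpen (V : Set G))
    (hU : IsOpen (U : Set G)) {n : ℕ} {f : Cochain V A (n + 1)}
    (hf : f ∈ Cocycle V A (n + 1)) :
    corCochain hUT hU (n + 1) (corCochain hVU hV (n + 1) f) -
      corCochain (hVU.trans hUT) hV (n + 1) f ∈ Coboundary T A (n + 1) := by
  classical
  have := finite_quotient_of_isOpen hVU hV
  have := finite_quotient_of_isOpen hUT hU
  have := finite_quotient_of_isOpen (hVU.trans hUT) hV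
  refine normCochain_sub_mem_coboundary (V.subgroupOf T) f.2.1 (rawD_eq_zero hf)
    (r := fun g => retract hVU (retract hUT g)) (s := retract (hVU.trans hUT))
    ((continuous_retract hVU hV).comp (continuous_retract hUT hU))
    (continuous_retract _ hV)
    -- Left translation by `V`; the value for `v` outside `V` is irrelevant.
    (fun v y => if hv : v ∈ V.subgroupOf T then ⟨v, hv⟩ * y else y) (fun v hv g => ?_)
    (fun v hv g => ?_) (fun v hv x => ?_) (fun x => ?_) (fun x => rfl)
  · rw [dif_pos hv, retract_mul' hUT (v := v) (hVU hv)]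
    exact retract_mul hVU ⟨v, hv⟩ _
  · rw [dif_pos hv]
    exact retract_mul' _ hv g
  · simp only [dif_pos hv]
    exact f.2.2 _ x
  · let _ : Fintype (U ⧸ V.subgroupOf U) := Fintype.ofFinite _
    have key := cosetSum_cosetSum (V := U.subgroupOf T) (W := V.subgroupOf T)
      (fun d : U ⧸ V.subgroupOf U => (⟨(Quotient.out d : U), hUT (Quotient.out d).2⟩ : T))
      (fun v hv => hVU hv) (fun d => (Quotient.out d).2) (fun d d' hd => ?_) (fun v hv => ?_)
      (y := fun g => f.1 fun i => retract hVU (retract hUT (g⁻¹ * x i))) (fun g v hv => ?_)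
    · rw [← key, corCochain_apply]
      refine congrArg (cosetSum _) (funext fun g => ?_)
      rw [corCochain_apply]
      refine Finset.sum_congr rfl fun d _ => congrArg f.1 (funext fun i => ?_)
      rw [mul_inv_rev, mul_assoc, ← retract_mul hUT]
      rfl
    · rw [← Quotient.out_eq' d, ← Quotient.out_eq' d']
      exact QuotientGroup.eq.2 hd
    · have h1 := QuotientGroup.eq.1 (Quotient.out_eq'
        (QuotientGroup.mk (⟨v, hv⟩ : U) : U ⧸ V.subgroupOf U))
      exact ⟨_, h1⟩
    · have hv' : v⁻¹ ∈ V.subgroupOf T := inv_mem hv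
      rw [← f.2.2 ⟨_, hv'⟩ (fun i => retract hVU (retract hUT (g⁻¹ * x i)))]
      refine congrArg f.1 (funext fun i => ?_)
      rw [mul_inv_rev, mul_assoc, retract_mul' hUT (v := v⁻¹) (hVU hv')]
      exact retract_mul hVU ⟨_, hv'⟩ _

theorem cor_cor (hVU : V ≤ U) (hUT : U ≤ T) (hV : IsOpen (V : Set G))
    (hU : IsOpen (U : Set G)) {n : ℕ} (x : H V A (n + 1)) :
    cor hUT hU (n + 1) (cor hVU hV (n + 1) x) = cor (hVU.trans hUT) hV (n + 1) x := by
  obtain ⟨f, rfl⟩ := QuotientAddGroup.mk_surjective x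
  exact (mk_eq_mk_iff _ _).2 (corCochain_corCochain_sub_mem hVU hUT hV hU f.2)

theorem corCochain_self_sub_mem (hU : IsOpen (U : Set G)) {n : ℕ} {f : Cochain U A (n + 1)}
    (hf : f ∈ Cocycle U A (n + 1)) :
    corCochain le_rfl hU (n + 1) f - f ∈ Coboundary U A (n + 1) := by
  classical
  have := finite_quotient_of_isOpen le_rfl hU
  refine normCochain_sub_mem_coboundary (U.subgroupOf U) f.2.1 (rawD_eq_zero hf)
    (r := retract le_rfl) (s := id) (continuous_retract _ hU) continuous_id (fun v y => v * y)
    (fun v hv g => retract_mul' _ hv g) (fun v hv g => rfl) (fun v hv x => f.2.2 v x)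
    (fun x => rfl) (fun x => ?_)
  have h1 : ∀ g : U, f.1 (fun i => id (g⁻¹ * x i)) = f.1 x := fun g => f.2.2 g⁻¹ x
  have h2 : Nat.card (U ⧸ U.subgroupOf U) = 1 := by
    rw [Subgroup.subgroupOf_self]
    exact Subgroup.index_top
  simp only [h1, cosetSum, Finset.sum_const, Finset.card_univ, ← Nat.card_eq_fintype_card, h2,
    one_smul]

theorem cor_self (hU : IsOpen (U : Set G)) {n : ℕ} (x : H U A (n + 1)) :
    cor le_rfl hU (n + 1) x = x := by
  obtain ⟨f, rfl⟩ := QuotientAddGroup.mk_surjective x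
  exact (mk_eq_mk_iff _ _).2 (corCochain_self_sub_mem hU f.2)

end Cor

/-! ## Shapiro's lemma -/

section Shapiro

variable {G : Type*} [Group G] [TopologicalSpace G]
  {k : Type*} [Field k] {U V : Subgroup G}

/-- The cochain with values in the functions on the cosets of `V` attached to a cochain of `V`. -/
noncomputable def shapiroCochain (h : V ≤ U) {n : ℕ} (f : Cochain V k n)
    (x : Fin (n + 1) → U) (g : U) : k := f.1 fun i => retract h (g⁻¹ * x i)

theorem rawD_shapiroCochain (h : V ≤ U) {n : ℕ} {f : Cochain V k n} (hf : f ∈ Cocycle V k n)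
    (x : Fin (n + 2) → U) : rawD (shapiroCochain h f) x = 0 := by
  funext g
  have h1 := rawD_map (Pi.evalAddMonoidHom (fun _ : U => k) g) (shapiroCochain h f)
  exact (congrFun h1 x).symm.trans (rawD_eq_zero hf fun i => retract h (g⁻¹ * x i))

variable [IsTopologicalGroup G]

/-- The injectivity half of Shapiro's lemma: evaluation at 1 and restriction to `V` carry a
primitive of the induced cochain to a primitive of `f`. -/
theorem mem_coboundary_of_rawD_eq_shapiroCochain (h : V ≤ U) {n : ℕ}
    {f : Cochain V k (n + 1)} {w : (Fin (n + 1) → U) → U → k}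
    (hw : IsCochain (translation k U) (rightInvariant k (V.subgroupOf U)) w)
    (hwf : rawD w = shapiroCochain h f) : f ∈ Coboundary V k (n + 1) := by
  -- The chosen representative of the trivial coset need not be 1, so the inclusion is not a section
  -- of the retraction; translation by `v₀⁻¹` repairs this.
  let v₀ : V := retract h 1
  let ι (v : V) : U := ⟨(v * v₀⁻¹ : V), h (v * v₀⁻¹).2⟩
  have hι : Continuous ι := by fun_prop
  have hr : ∀ v, retract h (ι v) = v := fun v => by
    have h1 := retract_mul h (v * v₀⁻¹) 1
    rw [mul_one] at h1
    rw [h1]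
    exact inv_mul_cancel_right v v₀
  refine ⟨⟨fun x => w (fun i => ι (x i)) 1, ?_, fun v x => ?_⟩, Subtype.ext (funext fun x => ?_)⟩
  · exact (hw.1.comp_continuous (f := fun x : Fin (n + 1) → V => fun i => ι (x i))
      (by fun_prop)).comp fun y : U → k => y 1
  · have h1 : (fun i => ι (v * x i)) = fun i => (⟨v, h v.2⟩ : U) * ι (x i) := by
      funext i
      exact Subtype.ext (by simp [ι, mul_assoc])
    have h2 := hw.map_mul ⟨v, h v.2⟩ fun i => ι (x i)
    have h3 := hw.mem (fun i => ι (x i)) 1 (⟨v, h v.2⟩ : U)⁻¹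
      (inv_mem (Subgroup.mem_subgroupOf.2 v.2))
    simp only [h1, h2, translation_apply]
    simpa using h3
  · have h1 := rawD_map (Pi.evalAddMonoidHom (fun _ : U => k) 1) w
    have h2 : rawD (fun x => w x 1) (fun i => ι (x i)) = rawD w (fun i => ι (x i)) 1 :=
      congrFun h1 fun i => ι (x i)
    refine h2.trans ?_
    rw [hwf]
    exact congrArg f.1 (funext fun i => by rw [inv_one, one_mul, hr])

variable [CompactSpace G]

theorem isCochain_shapiroCochain (h : V ≤ U) (hV : IsOpen (V : Set G)) {n : ℕ}
    (f : Cochain V k n) : IsCochain (translation k U) (rightInvariant k (V.subgroupOf U))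
      (shapiroCochain h f) := by
  have := finite_quotient_of_isOpen h hV
  have hmem : ∀ x, shapiroCochain h f x ∈ rightInvariant k (V.subgroupOf U) := fun x g v hv => by
    have hv' : v⁻¹ ∈ V.subgroupOf U := inv_mem hv
    rw [shapiroCochain, shapiroCochain, ← f.2.2 ⟨_, hv'⟩ (fun i => retract h (g⁻¹ * x i))]
    refine congrArg f.1 (funext fun i => ?_)
    rw [mul_inv_rev, mul_assoc]
    exact retract_mul' h hv' _
  refine ⟨isLocallyConstant_of_rightInvariant hmem fun g => ?_, fun g x => ?_, hmem⟩
  · have hr : Continuous (retract h) := continuous_retract h hV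
    exact f.2.1.comp_continuous
      (f := fun x : Fin (n + 1) → U => fun i => retract h (g⁻¹ * x i)) (by fun_prop)
  · funext y
    simp [shapiroCochain, mul_assoc]

end Shapiro

/-! ### Corestriction in the top degree and vanishing above it -/

section Duality

variable {p : ℕ} [Fact p.Prime] {G : Type*} [Group G] [TopologicalSpace G] [IsTopologicalGroup G]
  [CompactSpace G] {U V : Subgroup G} [CompactSpace U] {m : ℕ}

/-- An invariant functional of the induced cochain is a scalar multiple of its coset sum, which is
the corestriction. If that is a coboundary, duality with `B₀ = ⊥` makes the induced cochain one, and
Shapiro's lemma descends to `V`. -/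
theorem cor_injective (hU : IsGPD p (m + 1) U) (h : V ≤ U) (hV : IsOpen (V : Set G)) :
    Function.Injective (cor (A := ZMod p) h hV (m + 1)) := by
  refine (injective_iff_map_eq_zero _).2 fun x hx => ?_
  obtain ⟨f, rfl⟩ := QuotientAddGroup.mk_surjective x
  obtain ⟨hcf, hcf'⟩ := cor_mk h hV f
  rw [hcf'] at hx
  have hx' : corCochain h hV (m + 1) f.1 ∈ Coboundary U (ZMod p) (m + 1) := (mk_eq_zero_iff _).1 hx
  have := finite_quotient_of_isOpen h hV
  have hVo : IsOpen ((V.subgroupOf U : Subgroup U) : Set U) := hV.preimage continuous_subtype_val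
  have hX := isCochain_shapiroCochain h hV f.1
  obtain ⟨w, hw, hwX⟩ := exists_sub_rawD_mem (B₀ := ⊥) hU
    (isSmooth_rightInvariant (k := ZMod p) hVo) (fun g b hb => by simp_all) bot_le hX
    (fun x => rawD_shapiroCochain h f.2 x) (fun F hF _ => by
      obtain ⟨e, he⟩ := hx'
      refine mem_coboundary_succ ⟨fun x => F (indicator (ZMod p) (V.subgroupOf U)) * e.1 x,
        e.2.1.comp _, fun g x => congrArg _ (e.2.2 g x)⟩ fun x => ?_
      have h1 := rawD_map (AddMonoidHom.mulLeft (F (indicator (ZMod p) (V.subgroupOf U)))) e.1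
      refine (congrFun h1 x).trans ((hF.eq_cosetSum (hX.mem x)).trans ?_).symm
      exact congrArg _ (congrFun (congrArg Subtype.val he) x).symm)
  exact (mk_eq_zero_iff f).2 (mem_coboundary_of_rawD_eq_shapiroCochain h hw
    (funext fun x => (sub_eq_zero.1 (hwX x)).symm))

/-- Evaluating a closed lift of `t` at 1 gives a cocycle of `V`. Its corestriction and `t` are norms
of the same function along the retraction and along the identity. -/
theorem cor_surjective (hU : IsGPD p (m + 1) U) (h : V ≤ U) (hV : IsOpen (V : Set G)) :
    Function.Surjective (cor (A := ZMod p) h hV (m + 1)) := by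
  intro y
  obtain ⟨t, rfl⟩ := QuotientAddGroup.mk_surjective y
  have := finite_quotient_of_isOpen h hV
  have hVo : IsOpen ((V.subgroupOf U : Subgroup U) : Set U) := hV.preimage continuous_subtype_val
  obtain ⟨X, hX, hdX, hXt⟩ := exists_isCochain_cosetSum_eq hU hVo t.2
  have hφ : ∀ x, ∀ v ∈ V.subgroupOf U, X (fun i => v * x i) 1 = X x 1 := fun x v hv => by
    rw [hX.map_mul, translation_apply]
    exact (congrArg (X x) (by simp)).trans (hX.mem x 1 v⁻¹ (inv_mem hv))
  have hdφ : ∀ x, rawD (fun x => X x 1) x = 0 := fun x =>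
    (congrFun (rawD_map (Pi.evalAddMonoidHom (fun _ : U => ZMod p) 1) X) x).trans
      (congrFun (hdX x) 1)
  have hlc : IsLocallyConstant fun x => X x 1 := hX.1.comp fun y : U → ZMod p => y 1
  let ι (v : V) : U := ⟨v, h v.2⟩
  have hι : Continuous ι := by fun_prop
  let f : Cocycle V (ZMod p) (m + 1) := ⟨⟨fun x => X (fun i => ι (x i)) 1,
    hlc.comp_continuous (f := fun x : Fin (m + 2) → V => fun i => ι (x i)) (by fun_prop),
    fun v x => hφ (fun i => ι (x i)) (ι v) v.2⟩, Subtype.ext (funext fun x => hdφ fun i => ι (x i))⟩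
  refine ⟨QuotientAddGroup.mk f, (mk_eq_mk_iff _ _).2 ?_⟩
  refine normCochain_sub_mem_coboundary (V.subgroupOf U) hlc hdφ
    (r := fun u => ι (retract h u)) (s := id) (hι.comp (continuous_retract h hV)) continuous_id
    (fun v u => v * u) (fun v hv g => ?_) (fun v hv g => rfl) (fun v hv x => hφ x v hv)
    (fun x => rfl) (fun x => ?_)
  · rw [retract_mul' h hv]
    rfl
  · rw [← hXt]
    refine congrArg (cosetSum _) (funext fun g => ?_)
    simp only [id, hX.map_mul, translation_apply, inv_inv, mul_one]

/-- Shapiro's lemma transfers the vanishing from functions on the cosets to `V`, so `V` need not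
itself be known to satisfy duality. -/
theorem mem_coboundary_of_mem_cocycle (hU : IsGPD p (m + 1) U) (h : V ≤ U)
    (hV : IsOpen (V : Set G)) {f : Cochain V (ZMod p) (m + 2)}
    (hf : f ∈ Cocycle V (ZMod p) (m + 2)) : f ∈ Coboundary V (ZMod p) (m + 2) := by
  have hVo : IsOpen ((V.subgroupOf U : Subgroup U) : Set U) := hV.preimage continuous_subtype_val
  obtain ⟨w, hw, hwX⟩ := exists_rawD_eq_of_rightInvariant hU hVo (isCochain_shapiroCochain h hV f)
    (rawD_shapiroCochain h hf)
  exact mem_coboundary_of_rawD_eq_shapiroCochain h hw hwX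

end Duality

/-! ## Transport along isomorphisms -/

section Transport

variable {Γ Γ' : Type*} [Group Γ] [TopologicalSpace Γ] [Group Γ'] [TopologicalSpace Γ']

/-- Pullback of cochains along a continuous homomorphism. -/
def pullbackCochain {A : Type*} [AddCommGroup A] (e : Γ' →ₜ* Γ) (n : ℕ) :
    Cochain Γ A n →+ Cochain Γ' A n where
  toFun f := ⟨fun x => f.1 fun i => e (x i), f.2.1.comp_continuous
    (f := fun x : Fin (n + 1) → Γ' => fun i => e (x i))
    (continuous_pi fun i => e.continuous_toFun.comp (continuous_apply i)), fun g x => by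
      simp only [map_mul]
      exact f.2.2 (e g) fun i => e (x i)⟩
  map_zero' := rfl
  map_add' _ _ := rfl

/-- Pullback in cohomology along a continuous homomorphism. -/
def pullback (A : Type*) [AddCommGroup A] (e : Γ' →ₜ* Γ) (n : ℕ) : H Γ A n →+ H Γ' A n :=
  mapH (pullbackCochain e) (fun _ _ => rfl) n

theorem pullback_pullback {A : Type*} [AddCommGroup A] (e : Γ' →ₜ* Γ) (e' : Γ →ₜ* Γ')
    (h : ∀ g, e (e' g) = g) (n : ℕ) (x : H Γ A n) : pullback A e' n (pullback A e n x) = x := by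
  obtain ⟨f, rfl⟩ := QuotientAddGroup.mk_surjective x
  refine congrArg (QuotientAddGroup.mk (α := Cocycle Γ A n)) (Subtype.ext (Subtype.ext ?_))
  funext x
  exact congrArg f.1.1 (funext fun i => h (x i))

theorem pullback_cup {R : Type*} [CommRing R] (e : Γ' →ₜ* Γ) {i j n : ℕ} (h : i + j = n)
    (x : H Γ R i) (y : H Γ R j) :
    pullback R e n (cup h x y) = cup h (pullback R e i x) (pullback R e j y) := by
  obtain ⟨f, rfl⟩ := QuotientAddGroup.mk_surjective x
  obtain ⟨g, rfl⟩ := QuotientAddGroup.mk_surjective y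
  rfl

end Transport

end ContCoh

section TransportGPD

variable {p : ℕ} {Γ Γ' : Type*} [Group Γ] [TopologicalSpace Γ] [Group Γ'] [TopologicalSpace Γ']

theorem IsProPGroup.of_continuousMulEquiv (e : Γ' ≃ₜ* Γ) (h : IsProPGroup p Γ) :
    IsProPGroup p Γ' := by
  have := h.isTopologicalGroup
  have := h.compactSpace
  have := h.t2Space
  have := h.totallyDisconnectedSpace
  refine ⟨?_, e.symm.toHomeomorph.compactSpace, e.symm.toHomeomorph.t2Space,
    e.symm.toHomeomorph.totallyDisconnectedSpace, fun N => ?_⟩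
  · exact e.toHomeomorph.isInducing.topologicalGroup e.toMulEquiv
  · have hN : IsOpen
        (((N : Subgroup Γ').comap e.symm.toMulEquiv.toMonoidHom : Subgroup Γ) : Set Γ) :=
      N.toOpenSubgroup.isOpen.preimage e.symm.continuous
    obtain ⟨j, hj⟩ := h.exists_index_eq
      { toSubgroup := (N : Subgroup Γ').comap e.symm.toMulEquiv.toMonoidHom
        isOpen' := hN
        isNormal' := inferInstance }
    exact ⟨j, (Subgroup.index_comap_of_surjective _ e.symm.surjective).symm.trans hj⟩

theorem IsGPD.of_continuousMulEquiv {n : ℕ} (e : Γ' ≃ₜ* Γ) (h : IsGPD p n Γ) : IsGPD p n Γ' := by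
  let e₁ : Γ' →ₜ* Γ := e
  let e₂ : Γ →ₜ* Γ' := e.symm
  have h₁ : ∀ g, e₁ (e₂ g) = g := e.apply_symm_apply
  have h₂ : ∀ g, e₂ (e₁ g) = g := e.symm_apply_apply
  have hinj : ∀ i, Function.Injective (pullback (ZMod p) e₂ i) := fun i =>
    Function.LeftInverse.injective (g := pullback (ZMod p) e₁ i) (pullback_pullback e₂ e₁ h₂ i)
  obtain ⟨t⟩ := h.top_iso
  refine ⟨h.isProPGroup.of_continuousMulEquiv e, ?_, ⟨AddEquiv.trans ?_ t⟩, ?_, ?_⟩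
  · have := h.infinite
    exact Infinite.of_injective e.symm e.symm.injective
  · exact AddMonoidHom.toAddEquiv (pullback (ZMod p) e₂ n) (pullback (ZMod p) e₁ n)
      (AddMonoidHom.ext (pullback_pullback e₂ e₁ h₂ n))
      (AddMonoidHom.ext (pullback_pullback e₁ e₂ h₁ n))
  · intro i j hij x hx
    refine (map_eq_zero_iff _ (hinj i)).1 (h.nondegenerate_left i j hij _ fun y => ?_)
    rw [← pullback_pullback e₁ e₂ h₁ j y, ← pullback_cup, hx, map_zero]
  · intro i j hij y hy
    refine (map_eq_zero_iff _ (hinj j)).1 (h.nondegenerate_right i j hij _ fun x => ?_)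
    rw [← pullback_pullback e₁ e₂ h₁ i x, ← pullback_cup, hy, map_zero]

/-- The levels of the dualizing module are cohomology groups of subgroups, so the whole group has to
be replaced by `⊤`. -/
theorem IsGPD.top [IsTopologicalGroup Γ] {n : ℕ} (h : IsGPD p n Γ) :
    IsGPD p n (⊤ : Subgroup Γ) :=
  h.of_continuousMulEquiv
    { Subgroup.topEquiv with
      continuous_toFun := continuous_subtype_val
      continuous_invFun := continuous_id.subtype_mk _ }

end TransportGPD

namespace ContCoh

/-! ## Change of coefficients -/

section Coefficients

variable {Γ : Type*} [Group Γ] [TopologicalSpace Γ] {A B C : Type*} [AddCommGroup A]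
  [AddCommGroup B] [AddCommGroup C]

theorem coeffMap_coeffMap (a : A →+ B) (b : B →+ C) (n : ℕ) (x : H Γ A n) :
    coeffMap Γ b n (coeffMap Γ a n x) = coeffMap Γ (b.comp a) n x := by
  obtain ⟨f, rfl⟩ := QuotientAddGroup.mk_surjective x
  rfl

theorem coeffMap_id (n : ℕ) (x : H Γ A n) : coeffMap Γ (AddMonoidHom.id A) n x = x := by
  obtain ⟨f, rfl⟩ := QuotientAddGroup.mk_surjective x
  rfl

theorem coeffMap_nsmul_id (N n : ℕ) (x : H Γ A n) :
    coeffMap Γ (N • AddMonoidHom.id A) n x = N • x := by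
  obtain ⟨f, rfl⟩ := QuotientAddGroup.mk_surjective x
  refine Eq.trans ?_ (map_nsmul (QuotientAddGroup.mk' _) N f)
  refine congrArg (QuotientAddGroup.mk (α := Cocycle Γ A n)) (Subtype.ext (Subtype.ext ?_))
  funext x
  simp [coeffCochain]

theorem cor_coeffMap {G : Type*} [Group G] [TopologicalSpace G] [IsTopologicalGroup G]
    [CompactSpace G] {U V : Subgroup G} (h : V ≤ U) (hV : IsOpen (V : Set G)) (a : A →+ B) (n : ℕ)
    (x : H V A n) : cor h hV n (coeffMap V a n x) = coeffMap U a n (cor h hV n x) := by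
  obtain ⟨f, rfl⟩ := QuotientAddGroup.mk_surjective x
  refine congrArg (QuotientAddGroup.mk (α := Cocycle U B n)) (Subtype.ext (Subtype.ext ?_))
  funext x
  simp [coeffCochain, corCochain]

variable {ι : A →+ B} {π : B →+ C}

theorem exists_coeffCochain_eq (hπ : Function.Surjective π) {n : ℕ} (f : Cochain Γ C n) :
    ∃ F : Cochain Γ B n, coeffCochain π n F = f :=
  ⟨⟨fun x => Function.surjInv hπ (f.1 x), f.2.1.comp (Function.surjInv hπ),
    fun g x => congrArg _ (f.2.2 g x)⟩,
    Subtype.ext (funext fun _ => Function.surjInv_eq hπ _)⟩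

theorem exists_coeffCochain_eq_of_map_eq_zero
    (hex : Function.Exact ι π) {n : ℕ} (f : Cochain Γ B n) (hf : coeffCochain π n f = 0) :
    ∃ F : Cochain Γ A n, coeffCochain ι n F = f := by
  have hf' : ∀ x, ι (Function.invFun ι (f.1 x)) = f.1 x := fun x =>
    Function.invFun_eq ((hex _).1 (congrFun (congrArg Subtype.val hf) x))
  exact ⟨⟨fun x => Function.invFun ι (f.1 x), f.2.1.comp (Function.invFun ι),
    fun g x => congrArg _ (f.2.2 g x)⟩,
    Subtype.ext (funext hf')⟩

theorem d_coeffCochain (a : A →+ B) {n : ℕ} (f : Cochain Γ A n) :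
    d n (coeffCochain a n f) = coeffCochain a (n + 1) (d n f) :=
  Subtype.ext (rawD_map a f.1)

theorem d_d {n : ℕ} (f : Cochain Γ A n) : d (n + 1) (d n f) = 0 :=
  Subtype.ext (funext (rawD_rawD f.1))

theorem coeffCochain_injective (hι : Function.Injective ι) (n : ℕ) :
    Function.Injective (coeffCochain (G := Γ) ι n) := fun _ _ hfg =>
  Subtype.ext (funext fun x => hι (congrFun (congrArg Subtype.val hfg) x))

/-- If `Hⁿ⁺¹` of the subobject vanishes, then `Hⁿ` maps onto `Hⁿ` of the quotient. -/
theorem coeffMap_surjective (hι : Function.Injective ι) (hex : Function.Exact ι π)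
    (hπ : Function.Surjective π) {n : ℕ}
    (hvan : ∀ f ∈ Cocycle Γ A (n + 1), f ∈ Coboundary Γ A (n + 1)) :
    Function.Surjective (coeffMap Γ π n) := by
  intro y
  obtain ⟨f, rfl⟩ := QuotientAddGroup.mk_surjective y
  obtain ⟨F, hF⟩ := exists_coeffCochain_eq hπ f.1
  obtain ⟨h, hh⟩ := exists_coeffCochain_eq_of_map_eq_zero hex (d n F) (by
    rw [← d_coeffCochain, hF]
    exact f.2)
  obtain ⟨e, he⟩ := hvan h (coeffCochain_injective hι _ (by
    rw [← d_coeffCochain, hh, d_d, map_zero]))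
  refine ⟨QuotientAddGroup.mk ⟨F - coeffCochain ι n e, ?_⟩, ?_⟩
  · change d n _ = 0
    rw [map_sub, d_coeffCochain, he, hh, sub_self]
  · refine congrArg (QuotientAddGroup.mk (α := Cocycle Γ C n)) (Subtype.ext ?_)
    change coeffCochain π n (F - coeffCochain ι n e) = f.1
    rw [map_sub, hF, sub_eq_self]
    ext x
    exact hex.apply_apply_eq_zero (e.1 x)

/-- Exactness of the sequence of cohomology groups at the middle coefficients. -/
theorem exists_coeffMap_eq (hι : Function.Injective ι) (hex : Function.Exact ι π)
    (hπ : Function.Surjective π) {n : ℕ} {x : H Γ B (n + 1)} (hx : coeffMap Γ π (n + 1) x = 0) :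
    ∃ y, coeffMap Γ ι (n + 1) y = x := by
  obtain ⟨f, rfl⟩ := QuotientAddGroup.mk_surjective x
  obtain ⟨c, hc⟩ : coeffCochain π (n + 1) f.1 ∈ Coboundary Γ C (n + 1) :=
    (mk_eq_zero_iff (⟨coeffCochain π (n + 1) f.1, _⟩ : Cocycle Γ C (n + 1))).1 hx
  obtain ⟨e, he⟩ := exists_coeffCochain_eq hπ c
  obtain ⟨y, hy⟩ := exists_coeffCochain_eq_of_map_eq_zero hex (f.1 - d n e) (by
    rw [map_sub, ← d_coeffCochain, he, hc, sub_self])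
  have hf : d (n + 1) f.1 = 0 := f.2
  refine ⟨QuotientAddGroup.mk ⟨y, coeffCochain_injective hι _ ?_⟩, (mk_eq_mk_iff _ _).2 ?_⟩
  · rw [← d_coeffCochain, hy, map_sub, d_d, hf, sub_self, map_zero]
  · change coeffCochain ι (n + 1) y - f.1 ∈ _
    rw [hy, sub_sub_cancel_left]
    exact neg_mem ⟨e, rfl⟩

end Coefficients

section ZMod

/-- Multiplication by `b` as a map `ℤ/a → ℤ/c`, where `c = b a`. -/
def mulZMod {a b c : ℕ} (h : c = b * a) : ZMod a →+ ZMod c :=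
  ZMod.lift a ⟨(zmultiplesHom (ZMod c)) (b : ZMod c), by
    subst h
    simpa [mul_comm] using ZMod.natCast_self (b * a)⟩

theorem mulZMod_intCast {a b c : ℕ} (h : c = b * a) (j : ℤ) : mulZMod h j = b * j := by
  simp [mulZMod, mul_comm]

theorem mulZMod_injective {a b c : ℕ} (h : c = b * a) (hb : b ≠ 0) :
    Function.Injective (mulZMod h) := by
  refine (injective_iff_map_eq_zero _).2 fun x hx => ?_
  obtain ⟨j, rfl⟩ := ZMod.intCast_surjective x
  rw [mulZMod_intCast, ← Int.cast_natCast, ← Int.cast_mul, ZMod.intCast_zmod_eq_zero_iff_dvd, h,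
    Nat.cast_mul] at hx
  exact (ZMod.intCast_zmod_eq_zero_iff_dvd _ _).2
    (Int.dvd_of_mul_dvd_mul_left (by exact_mod_cast hb) hx)

theorem mulZMod_exact {a b c : ℕ} (h : c = b * a) (hbc : b ∣ c) :
    Function.Exact (mulZMod h) (ZMod.castHom hbc (ZMod b)).toAddMonoidHom := by
  intro x
  obtain ⟨j, rfl⟩ := ZMod.intCast_surjective x
  have h1 : (ZMod.castHom hbc (ZMod b)).toAddMonoidHom (j : ZMod c) = (j : ZMod b) :=
    map_intCast (ZMod.castHom hbc (ZMod b)) j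
  rw [h1, ZMod.intCast_zmod_eq_zero_iff_dvd]
  constructor
  · rintro ⟨l, rfl⟩
    exact ⟨(l : ZMod a), by rw [mulZMod_intCast]; push_cast; rfl⟩
  · rintro ⟨y, hy⟩
    obtain ⟨l, rfl⟩ := ZMod.intCast_surjective y
    rw [mulZMod_intCast] at hy
    have h2 : (j : ZMod b) = 0 := by
      rw [← h1, ← hy]
      change ZMod.castHom hbc (ZMod b) _ = 0
      rw [map_mul, map_natCast, ZMod.natCast_self, zero_mul]
    exact (ZMod.intCast_zmod_eq_zero_iff_dvd _ _).1 h2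

end ZMod

end ContCoh

/-! ## Torsion groups with a cyclic socle -/

section Prufer

theorem nonempty_addEquiv_zmod {I : Type*} [AddCommGroup I] {N : ℕ} {x : I}
    (hx : addOrderOf x = N) (h : ∀ y, y ∈ AddSubgroup.zmultiples x) : Nonempty (I ≃+ ZMod N) := by
  have : IsAddCyclic I := ⟨x, h⟩
  have hcard : Nat.card I = N := hx ▸ (addOrderOf_eq_card_of_forall_mem_zmultiples h).symm
  subst hcard
  exact ⟨(zmodAddCyclicAddEquiv this).symm⟩

variable {p : ℕ} [Fact p.Prime]

theorem PruferGroup.mk_eq_zero_iff (q : ℚ_[p]) :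
    (QuotientAddGroup.mk q : PruferGroup p) = 0 ↔ ‖q‖ ≤ 1 :=
  QuotientAddGroup.eq_zero_iff q

theorem PruferGroup.nsmul_mk_eq_zero_iff (N : ℕ) (q : ℚ_[p]) :
    N • (QuotientAddGroup.mk q : PruferGroup p) = 0 ↔ ‖(N : ℚ_[p]) * q‖ ≤ 1 := by
  rw [← nsmul_eq_mul, ← mk_eq_zero_iff]
  rfl

/-- The quotient of `q'` by `q` is a `p`-adic integer, and a natural number close enough to it has
the same effect on the class of `q`. -/
theorem PruferGroup.exists_nsmul_eq {q q' : ℚ_[p]} (h : ‖q'‖ ≤ ‖q‖) :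
    ∃ m : ℕ, (QuotientAddGroup.mk q' : PruferGroup p) = m • QuotientAddGroup.mk q := by
  rcases eq_or_ne q 0 with rfl | hq
  · rw [norm_zero, norm_le_zero_iff] at h
    exact ⟨0, by rw [h]; exact (zero_smul ℕ _).symm⟩
  have hq0 : 0 < ‖q‖ := norm_pos_iff.2 hq
  let u : ℤ_[p] := ⟨q' / q, by
    rw [norm_div]
    exact div_le_one_of_le₀ h hq0.le⟩
  obtain ⟨m, hm⟩ := PadicInt.denseRange_natCast.exists_dist_lt u (inv_pos.2 hq0)
  refine ⟨m, ?_⟩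
  have h1 : ‖q' - m * q‖ ≤ 1 := by
    have h2 : q' - m * q = ((u - m : ℤ_[p]) : ℚ_[p]) * q := by
      have h3 : (u : ℚ_[p]) = q' / q := rfl
      rw [PadicInt.coe_sub, PadicInt.coe_natCast, h3, sub_mul, div_mul_cancel₀ _ hq]
    rw [h2, norm_mul]
    rw [dist_eq_norm] at hm
    calc ‖((u - m : ℤ_[p]) : ℚ_[p])‖ * ‖q‖ ≤ ‖q‖⁻¹ * ‖q‖ := by
          gcongr
          exact hm.le
      _ = 1 := inv_mul_cancel₀ hq0.ne'
  rw [← sub_eq_zero, ← nsmul_eq_mul] at *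
  exact (mk_eq_zero_iff _).2 h1

theorem PruferGroup.exists_pow_smul_eq_zero (q : ℚ_[p]) :
    ∃ s : ℕ, ‖((p ^ s : ℕ) : ℚ_[p]) * q‖ ≤ 1 := by
  have h1 : (p : ℝ)⁻¹ < 1 := inv_lt_one_of_one_lt₀ (by exact_mod_cast (Fact.out : p.Prime).one_lt)
  obtain ⟨s, hs⟩ := exists_pow_lt_of_lt_one (x := (‖q‖ + 1)⁻¹) (by positivity) h1
  refine ⟨s, ?_⟩
  rw [norm_mul, Nat.cast_pow, norm_pow, Padic.norm_p]
  have h2 : 0 < ‖q‖ + 1 := by positivity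
  calc ((p : ℝ)⁻¹) ^ s * ‖q‖ ≤ (‖q‖ + 1)⁻¹ * (‖q‖ + 1) := by gcongr; linarith
    _ = 1 := inv_mul_cancel₀ h2.ne'

variable {I : Type*} [AddCommGroup I] {e : I}

/-- The socle embeds, and divisibility extends this embedding to all of `I`. The extension stays
injective because a nonzero subgroup of a `p`-primary group meets the socle. -/
theorem exists_injective_pruferGroup (htors : ∀ x : I, ∃ k : ℕ, p ^ k • x = 0) (he : p • e = 0)
    (he0 : e ≠ 0) (h : ∀ x : I, p • x = 0 → ∃ k : ℤ, x = k • e) :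
    ∃ j : I →+ PruferGroup p, Function.Injective j := by
  have hp : (p : ℚ_[p]) ≠ 0 := by exact_mod_cast (Fact.out : p.Prime).ne_zero
  have hord : addOrderOf e = p := addOrderOf_eq_prime he he0
  let u : PruferGroup p := QuotientAddGroup.mk (p : ℚ_[p])⁻¹
  have hu : p • u = 0 := by
    rw [PruferGroup.nsmul_mk_eq_zero_iff, mul_inv_cancel₀ hp, norm_one]
  have hu0 : u ≠ 0 := by
    intro h0
    have h1 := (PruferGroup.mk_eq_zero_iff _).1 h0
    rw [norm_inv, Padic.norm_p, inv_inv] at h1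
    exact (by exact_mod_cast (Fact.out : p.Prime).one_lt : (1 : ℝ) < p).not_ge h1
  have hordu : addOrderOf u = p := addOrderOf_eq_prime hu hu0
  let f : ZMod p →+ I := ZMod.lift p ⟨zmultiplesHom I e, by simpa using he⟩
  let g : ZMod p →+ PruferGroup p := ZMod.lift p ⟨zmultiplesHom _ u, by simpa using hu⟩
  have hf : ∀ k : ℤ, f k = k • e := fun k => by simp [f]
  have hg : ∀ k : ℤ, g k = k • u := fun k => by simp [g]
  have hfinj : Function.Injective f := by
    refine (injective_iff_map_eq_zero f).2 fun x hx => ?_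
    obtain ⟨k, rfl⟩ := ZMod.intCast_surjective x
    rw [hf, ← addOrderOf_dvd_iff_zsmul_eq_zero, hord] at hx
    exact (ZMod.intCast_zmod_eq_zero_iff_dvd _ _).2 hx
  let _ : DivisibleBy (PruferGroup p) ℤ := Function.Surjective.divisibleBy
    (QuotientAddGroup.mk : ℚ_[p] → PruferGroup p) QuotientAddGroup.mk_surjective fun _ _ => rfl
  obtain ⟨j, hj⟩ := (Module.Baer.of_divisible (PruferGroup p)).extension_property_addMonoidHom
    f hfinj g
  refine ⟨j, (injective_iff_map_eq_zero j).2 fun x hx => ?_⟩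
  obtain ⟨k, hk⟩ := htors x
  induction k generalizing x with
  | zero => simpa using hk
  | succ k ih =>
    have h1 : p • x = 0 := ih (p • x) (by rw [map_nsmul, hx, smul_zero])
      (by rw [smul_smul, ← pow_succ, hk])
    obtain ⟨c, rfl⟩ := h x h1
    have h2 : j (c • e) = c • u := by rw [← hf, ← hg, ← hj]; rfl
    rw [h2, ← addOrderOf_dvd_iff_zsmul_eq_zero, hordu] at hx
    rwa [← addOrderOf_dvd_iff_zsmul_eq_zero, hord]

/-- A `p`-primary torsion group with socle of order `p` is cyclic or a Prüfer group. -/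
theorem nonempty_addEquiv_pruferGroup_or_zmod (htors : ∀ x : I, ∃ k : ℕ, p ^ k • x = 0)
    (he : p • e = 0) (he0 : e ≠ 0) (h : ∀ x : I, p • x = 0 → ∃ k : ℤ, x = k • e) :
    Nonempty (I ≃+ PruferGroup p) ∨ ∃ s : ℕ, 1 ≤ s ∧ Nonempty (I ≃+ ZMod (p ^ s)) := by
  obtain ⟨j, hj⟩ := exists_injective_pruferGroup htors he he0 h
  have hjs : ∀ (N : ℕ) (x : I) (q : ℚ_[p]), QuotientAddGroup.mk q = j x →
      (N • x = 0 ↔ ‖(N : ℚ_[p]) * q‖ ≤ 1) := fun N x q hq => by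
    rw [← PruferGroup.nsmul_mk_eq_zero_iff, hq, ← map_nsmul, map_eq_zero_iff j hj]
  have hpn : ∀ s : ℕ, ‖((p ^ s : ℕ) : ℚ_[p])‖ = ((p : ℝ) ^ s)⁻¹ := fun s => by
    rw [Nat.cast_pow, norm_pow, Padic.norm_p, inv_pow]
  have hp0 : ∀ s : ℕ, 0 < (p : ℝ) ^ s := fun s =>
    pow_pos (by exact_mod_cast (Fact.out : p.Prime).pos) s
  by_cases hb : ∃ s, ∀ x : I, p ^ s • x = 0
  · right
    classical
    let s := Nat.find hb
    have hs : ∀ x : I, p ^ s • x = 0 := Nat.find_spec hb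
    obtain ⟨t, ht⟩ : ∃ t, s = t + 1 := Nat.exists_eq_succ_of_ne_zero fun h0 => he0 (by
      have := hs e
      rwa [h0, pow_zero, one_smul] at this)
    obtain ⟨x, hx⟩ : ∃ x : I, p ^ t • x ≠ 0 := by
      have := Nat.find_min hb (m := t) (by omega)
      push Not at this
      exact this
    refine ⟨s, by omega, nonempty_addEquiv_zmod (x := x) ?_ fun y => ?_⟩
    · rw [ht]
      exact addOrderOf_eq_prime_pow hx (ht ▸ hs x)
    · obtain ⟨q, hq⟩ := QuotientAddGroup.mk_surjective (j x)
      obtain ⟨q', hq'⟩ := QuotientAddGroup.mk_surjective (j y)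
      have h1 := (hjs _ y q' hq').1 (hs y)
      have h2 := (hjs _ x q hq).not.1 hx
      rw [norm_mul, hpn, inv_mul_le_one₀ (hp0 _)] at h1 h2
      -- Norms are powers of `p`, so a norm exceeding `p ^ t` is at least `p ^ s`, which bounds the
      -- norm of `q'`.
      have h3 : ‖q'‖ ≤ ‖q‖ := by
        refine h1.trans (le_of_not_gt fun h4 => h2 ?_)
        have h5 := (Padic.norm_le_pow_iff_norm_lt_pow_add_one q (t : ℤ)).2
        rw [ht] at h4
        exact_mod_cast h5 (by exact_mod_cast h4)
      obtain ⟨m, hm⟩ := PruferGroup.exists_nsmul_eq h3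
      rw [hq, hq', ← map_nsmul] at hm
      exact ⟨m, by simpa using (hj hm).symm⟩
  · left
    push Not at hb
    refine ⟨AddEquiv.ofBijective j ⟨hj, fun z => ?_⟩⟩
    obtain ⟨q', rfl⟩ := QuotientAddGroup.mk_surjective z
    obtain ⟨s, hs⟩ := PruferGroup.exists_pow_smul_eq_zero q'
    obtain ⟨x, hx⟩ := hb s
    obtain ⟨q, hq⟩ := QuotientAddGroup.mk_surjective (j x)
    have h2 := (hjs _ x q hq).not.1 hx
    rw [norm_mul, hpn, inv_mul_le_one₀ (hp0 _)] at hs h2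
    obtain ⟨m, hm⟩ := PruferGroup.exists_nsmul_eq (hs.trans (le_of_not_ge h2))
    exact ⟨m • x, by rw [map_nsmul, ← hq, hm]⟩

theorem nonempty_torsionBy_addEquiv [Module ℤ I] (he : p • e = 0) (he0 : e ≠ 0)
    (h : ∀ x : I, p • x = 0 → ∃ k : ℤ, x = k • e) :
    Nonempty (Submodule.torsionBy ℤ I (p : ℤ) ≃+ ZMod p) := by
  have hmem : ∀ x : I, x ∈ Submodule.torsionBy ℤ I (p : ℤ) ↔ p • x = 0 := fun x => by
    rw [Submodule.mem_torsionBy_iff, Nat.cast_smul_eq_nsmul]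
  refine nonempty_addEquiv_zmod (x := ⟨e, (hmem e).2 he⟩) (addOrderOf_eq_prime ?_ ?_) fun y => ?_
  · exact Subtype.ext he
  · simpa [Subtype.ext_iff] using he0
  · obtain ⟨k, hk⟩ := h y.1 ((hmem _).1 y.2)
    exact ⟨k, Subtype.ext hk.symm⟩

end Prufer

/-! ## Direct limits of character groups -/

section DualLimit

variable {p : ℕ} [Fact p.Prime]

theorem exists_character_zmod : ∃ χ : ZMod p →+ AddCircle (1 : ℚ), Function.Injective χ ∧
    ∀ t : AddCircle (1 : ℚ), p • t = 0 → ∃ k : ℤ, t = k • χ 1 := by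
  have hp : (p : ℚ) ≠ 0 := by exact_mod_cast (Fact.out : p.Prime).ne_zero
  let u : AddCircle (1 : ℚ) := ((p : ℚ)⁻¹ : ℚ)
  have hz : ∀ k : ℤ, k • u = ((k * (p : ℚ)⁻¹ : ℚ) : AddCircle (1 : ℚ)) := fun k => by
    rw [← zsmul_eq_mul]
    rfl
  let χ : ZMod p →+ AddCircle (1 : ℚ) := ZMod.lift p ⟨zmultiplesHom _ u, by
    refine (hz p).trans ?_
    rw [Int.cast_natCast, mul_inv_cancel₀ hp]
    exact AddCircle.coe_period 1⟩
  have hχ : ∀ k : ℤ, χ k = k • u := fun k => by simp [χ]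
  refine ⟨χ, (injective_iff_map_eq_zero χ).2 fun x hx => ?_, fun t ht => ?_⟩
  · obtain ⟨k, rfl⟩ := ZMod.intCast_surjective x
    rw [hχ, hz, AddCircle.coe_eq_zero_iff] at hx
    obtain ⟨l, hl⟩ := hx
    rw [zsmul_eq_mul, mul_one, eq_mul_inv_iff_mul_eq₀ hp] at hl
    refine (ZMod.intCast_zmod_eq_zero_iff_dvd _ _).2 ⟨l, ?_⟩
    have : l * (p : ℤ) = k := by exact_mod_cast hl
    rw [← this, mul_comm]
  · obtain ⟨q, rfl⟩ := QuotientAddGroup.mk_surjective t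
    have h1 : ((p • q : ℚ) : AddCircle (1 : ℚ)) = 0 := ht
    rw [AddCircle.coe_eq_zero_iff] at h1
    obtain ⟨l, hl⟩ := h1
    rw [zsmul_eq_mul, mul_one, nsmul_eq_mul] at hl
    refine ⟨l, ?_⟩
    have h2 : χ 1 = u := by simpa using hχ 1
    rw [h2, hz, hl, mul_comm (p : ℚ), mul_inv_cancel_right₀ hp]

variable {ι : Type*} [Preorder ι] [IsDirectedOrder ι] [Nonempty ι] [DecidableEq ι]
  {M : ι → Type*} [∀ a, AddCommGroup (M a)] (f : ∀ a b, a ≤ b → M b →+ M a)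

/-- The direct limit of the character groups of an inverse system of groups `M a` of `p`-power
exponent, such that `M a / p` is compatibly isomorphic to `𝔽_p`, has socle of order `p`. -/
theorem exists_socle_generator (f_self : ∀ a x, f a a le_rfl x = x)
    (f_comp : ∀ a b c (hab : a ≤ b) (hbc : b ≤ c) x,
      f a b hab (f b c hbc x) = f a c (hab.trans hbc) x)
    (htors : ∀ a, ∃ k : ℕ, ∀ x : M a, p ^ k • x = 0) (a₀ : ι) (θ : ∀ a, a₀ ≤ a → M a →+ ZMod p)
    (hθf : ∀ a b (ha : a₀ ≤ a) (hab : a ≤ b) x, θ a ha (f a b hab x) = θ b (ha.trans hab) x)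
    (hθs : ∀ a ha, Function.Surjective (θ a ha))
    (hθk : ∀ a ha x, θ a ha x = 0 → ∃ y, x = p • y) :
    (∀ x : Module.DirectLimit (R := ℤ) (fun a => CharacterModule (M a))
      (fun a b h => CharacterModule.dual (f a b h).toIntLinearMap), ∃ k : ℕ, p ^ k • x = 0) ∧
    ∃ e : Module.DirectLimit (R := ℤ) (fun a => CharacterModule (M a))
      (fun a b h => CharacterModule.dual (f a b h).toIntLinearMap),
      e ≠ 0 ∧ p • e = 0 ∧ ∀ x, p • x = 0 → ∃ k : ℤ, x = k • e := by
  let F : ∀ a b, a ≤ b → CharacterModule (M a) →ₗ[ℤ] CharacterModule (M b) :=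
    fun a b h => CharacterModule.dual (f a b h).toIntLinearMap
  have hF : ∀ a b (h : a ≤ b) (y : CharacterModule (M a)) x, F a b h y x = y (f a b h x) :=
    fun _ _ _ _ _ => rfl
  have hsys : DirectedSystem (fun a => CharacterModule (M a)) fun a b h => F a b h :=
    { map_self := fun a y => DFunLike.ext _ _ fun x => by rw [hF, f_self]
      map_map := fun a b c hab hbc y => DFunLike.ext _ _ fun x => by rw [hF, hF, hF, f_comp] }
  let of (a) : CharacterModule (M a) →ₗ[ℤ] Module.DirectLimit (fun a => CharacterModule (M a)) F :=
    Module.DirectLimit.of ℤ ι _ F a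
  have hof : ∀ a b (h : a ≤ b) y, of b (F a b h y) = of a y :=
    fun _ _ _ _ => Module.DirectLimit.of_f
  obtain ⟨χ, hχ, hχ'⟩ := exists_character_zmod (p := p)
  let ε (a) (ha : a₀ ≤ a) : CharacterModule (M a) := χ.comp (θ a ha)
  have hε : ∀ a ha x, ε a ha x = χ (θ a ha x) := fun _ _ _ => rfl
  have hεF : ∀ a (ha : a₀ ≤ a), F a₀ a ha (ε a₀ le_rfl) = ε a ha := fun a ha =>
    DFunLike.ext _ _ fun x => by rw [hF, hε, hε, hθf]
  have hpε : p • ε a₀ le_rfl = 0 := DFunLike.ext _ _ fun x => by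
    change p • χ (θ a₀ le_rfl x) = 0
    rw [← map_nsmul, ← Nat.cast_smul_eq_nsmul (ZMod p), CharP.cast_eq_zero, zero_smul, map_zero]
  refine ⟨fun x => ?_, of a₀ (ε a₀ le_rfl), fun h0 => ?_, ?_, fun x hx => ?_⟩
  · obtain ⟨a, y, rfl⟩ := Module.DirectLimit.exists_of x
    obtain ⟨k, hk⟩ := htors a
    refine ⟨k, ?_⟩
    have h1 : p ^ k • y = 0 := DFunLike.ext _ _ fun x => by
      change p ^ k • y x = 0
      rw [← map_nsmul, hk, map_zero]
    rw [← map_nsmul, h1, map_zero]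
  · obtain ⟨b, hb, h1⟩ := Module.DirectLimit.of.zero_exact h0
    obtain ⟨x, hx⟩ := hθs b hb 1
    have h2 : ε b hb x = 0 := by
      rw [← hεF b hb]
      exact DFunLike.congr_fun h1 x
    rw [hε, hx, map_eq_zero_iff χ hχ] at h2
    exact one_ne_zero h2
  · rw [← map_nsmul, hpε, map_zero]
  · obtain ⟨a, y, rfl⟩ := Module.DirectLimit.exists_of x
    rw [← map_nsmul] at hx
    obtain ⟨b, hab, h1⟩ := Module.DirectLimit.of.zero_exact hx
    obtain ⟨c, hbc, hc⟩ := exists_ge_ge b a₀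
    -- At this level the character kills all multiples of `p`, hence the kernel of `θ`; it is
    -- determined by its value at a preimage of 1.
    let y' := F a c (hab.trans hbc) y
    have hy' : ∀ x, y' (p • x) = 0 := fun x => by
      have h2 := DFunLike.congr_fun h1 (f b c hbc x)
      change p • y (f a b hab (f b c hbc x)) = 0 at h2
      rw [map_nsmul, hF, ← f_comp a b c hab hbc, h2]
    obtain ⟨x₀, hx₀⟩ := hθs c hc 1
    obtain ⟨k, hk⟩ := hχ' (y' x₀) (by rw [← map_nsmul, hy'])
    refine ⟨k, ?_⟩
    have h3 : y' = k • ε c hc := DFunLike.ext _ _ fun x => by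
      obtain ⟨l, hl⟩ := ZMod.intCast_surjective (θ c hc x)
      obtain ⟨z, hz⟩ := hθk c hc (x - l • x₀) (by
        rw [map_sub, map_zsmul, hx₀, ← hl, zsmul_one, sub_self])
      have h4 : y' x = l • y' x₀ := by
        have h5 := hy' z
        rw [← hz, map_sub, map_zsmul, sub_eq_zero] at h5
        exact h5
      have h6 : χ (θ c hc x) = l • χ 1 := by rw [← hl, ← map_zsmul, zsmul_one]
      change y' x = k • χ (θ c hc x)
      rw [h4, hk, h6, smul_comm]
    rw [← hof a₀ c hc, hεF, ← map_zsmul, ← h3]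
    exact (hof a c _ y).symm

end DualLimit

namespace ContCoh

/-! ### Coefficients ℤ/pⁱ and the inverse system of levels -/

section Levels

variable {p m : ℕ} {G : Type*} [Group G] [TopologicalSpace G]

theorem castHom_comp_castHom {a b c : ℕ} (hba : b ∣ a) (hcb : c ∣ b) :
    ((ZMod.castHom hcb (ZMod c)).toAddMonoidHom).comp (ZMod.castHom hba (ZMod b)).toAddMonoidHom =
      (ZMod.castHom (hcb.trans hba) (ZMod c)).toAddMonoidHom :=
  congrArg RingHom.toAddMonoidHom (Subsingleton.elim
    ((ZMod.castHom hcb (ZMod c)).comp (ZMod.castHom hba (ZMod b))) _)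

theorem castHom_self_toAddMonoidHom {a : ℕ} (h : a ∣ a) :
    (ZMod.castHom h (ZMod a)).toAddMonoidHom = AddMonoidHom.id _ :=
  congrArg RingHom.toAddMonoidHom (Subsingleton.elim (ZMod.castHom h (ZMod a)) (RingHom.id _))

section Reduction

variable [Fact p.Prime]

/-- Reduction of coefficients is surjective on `Hⁿ` if `Hⁿ⁺¹` vanishes with coefficients `𝔽_p`. -/
theorem coeffMap_castHom_pow_surjective {Γ : Type*} [Group Γ] [TopologicalSpace Γ] {n : ℕ}
    (hvan : ∀ f ∈ Cocycle Γ (ZMod p) (n + 1), f ∈ Coboundary Γ (ZMod p) (n + 1)) (i : ℕ) :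
    Function.Surjective (coeffMap Γ (ZMod.castHom (pow_dvd_pow p i.le_succ)
      (ZMod (p ^ i))).toAddMonoidHom n) :=
  coeffMap_surjective (mulZMod_injective (pow_succ p i) (pow_ne_zero _ (NeZero.ne p)))
    (mulZMod_exact (pow_succ p i) (pow_dvd_pow p i.le_succ))
    (ZMod.castHom_surjective (pow_dvd_pow p i.le_succ)) hvan

theorem coeffMap_castHom_surjective {Γ : Type*} [Group Γ] [TopologicalSpace Γ] {n : ℕ}
    (hvan : ∀ f ∈ Cocycle Γ (ZMod p) (n + 1), f ∈ Coboundary Γ (ZMod p) (n + 1)) {i : ℕ}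
    (hi : p ∣ p ^ i) :
    Function.Surjective (coeffMap Γ (ZMod.castHom hi (ZMod p)).toAddMonoidHom n) := by
  have hi1 : 1 ≤ i := by
    by_contra h0
    obtain rfl : i = 0 := by omega
    exact (Fact.out : p.Prime).one_lt.ne' (Nat.dvd_one.1 hi)
  induction i, hi1 using Nat.le_induction with
  | base =>
    intro x
    have h1 : p ^ 1 ∣ p := (pow_one p).dvd
    refine ⟨coeffMap Γ (ZMod.castHom h1 (ZMod (p ^ 1))).toAddMonoidHom n x, ?_⟩
    rw [coeffMap_coeffMap, castHom_comp_castHom, castHom_self_toAddMonoidHom, coeffMap_id]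
  | succ i hi1 ih =>
    have h2 : p ∣ p ^ i := dvd_pow_self p (by omega)
    intro x
    obtain ⟨y, rfl⟩ := ih h2 x
    obtain ⟨z, rfl⟩ := coeffMap_castHom_pow_surjective hvan i y
    exact ⟨z, by rw [coeffMap_coeffMap, castHom_comp_castHom]⟩

/-- The class comes from ℤ/pᵗ along multiplication by `p`, with i = t + 1, and its source lifts back
to ℤ/pⁱ; reduction followed by that inclusion is multiplication by `p`. -/
theorem exists_eq_nsmul_of_coeffMap_castHom_eq_zero {Γ : Type*} [Group Γ] [TopologicalSpace Γ]
    {n : ℕ} (hvan : ∀ f ∈ Cocycle Γ (ZMod p) (n + 2), f ∈ Coboundary Γ (ZMod p) (n + 2)) {i : ℕ}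
    (hi : p ∣ p ^ i) {x : H Γ (ZMod (p ^ i)) (n + 1)}
    (hx : coeffMap Γ (ZMod.castHom hi (ZMod p)).toAddMonoidHom (n + 1) x = 0) :
    ∃ y, x = p • y := by
  obtain ⟨t, rfl⟩ : ∃ t, i = t + 1 := Nat.exists_eq_succ_of_ne_zero fun h0 => by
    subst h0
    exact (Fact.out : p.Prime).one_lt.ne' (Nat.dvd_one.1 hi)
  obtain ⟨y, rfl⟩ := exists_coeffMap_eq (mulZMod_injective (pow_succ' p t) (NeZero.ne p))
    (mulZMod_exact (pow_succ' p t) hi) (ZMod.castHom_surjective hi) hx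
  obtain ⟨z, rfl⟩ := coeffMap_castHom_pow_surjective hvan t y
  refine ⟨z, ?_⟩
  rw [coeffMap_coeffMap, ← coeffMap_nsmul_id]
  refine congrArg (fun a => coeffMap Γ a (n + 1) z) (AddMonoidHom.ext fun j => ?_)
  obtain ⟨j, rfl⟩ := ZMod.intCast_surjective j
  have h1 : (ZMod.castHom (pow_dvd_pow p t.le_succ) (ZMod (p ^ t))).toAddMonoidHom
      (j : ZMod (p ^ (t + 1))) = (j : ZMod (p ^ t)) :=
    map_intCast (ZMod.castHom (pow_dvd_pow p t.le_succ) (ZMod (p ^ t))) j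
  rw [AddMonoidHom.comp_apply, h1, mulZMod_intCast]
  simp

end Reduction

variable [IsTopologicalGroup G] [CompactSpace G]

theorem cor_coeffMap_cor_coeffMap {A B C : Type*} [AddCommGroup A] [AddCommGroup B]
    [AddCommGroup C] {T U V : Subgroup G} (hVU : V ≤ U) (hUT : U ≤ T) (hV : IsOpen (V : Set G))
    (hU : IsOpen (U : Set G)) (a : A →+ B) (b : B →+ C) (x : H V A (m + 1)) :
    cor hUT hU (m + 1) (coeffMap U b (m + 1) (cor hVU hV (m + 1) (coeffMap V a (m + 1) x))) =
      cor (hVU.trans hUT) hV (m + 1) (coeffMap V (b.comp a) (m + 1) x) := by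
  rw [← cor_coeffMap, coeffMap_coeffMap, cor_cor]

theorem levelMap_self (a : ℕ × (OpenSubgroup G)ᵒᵈ) (x : LevelH p (m + 1) G a) :
    levelMap p (m + 1) a a le_rfl x = x := by
  rw [levelMap, AddMonoidHom.comp_apply, castHom_self_toAddMonoidHom, coeffMap_id]
  exact cor_self _ x

theorem levelMap_levelMap (a b c : ℕ × (OpenSubgroup G)ᵒᵈ) (hab : a ≤ b) (hbc : b ≤ c)
    (x : LevelH p (m + 1) G c) :
    levelMap p (m + 1) a b hab (levelMap p (m + 1) b c hbc x) =
      levelMap p (m + 1) a c (hab.trans hbc) x := by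
  refine (cor_coeffMap_cor_coeffMap (OrderDual.ofDual_le_ofDual.2 hbc.2)
    (OrderDual.ofDual_le_ofDual.2 hab.2) _ _ _ _ x).trans ?_
  rw [castHom_comp_castHom]
  rfl

end Levels

end ContCoh

theorem mainTheorem2 (p : ℕ) [Fact p.Prime] (n : ℕ) (hn : 1 ≤ n)
    (G : Type*) [Group G] [TopologicalSpace G] [IsTopologicalGroup G] [CompactSpace G]
    (hG : IsGPD p n G) :
    Nonempty (Submodule.torsionBy ℤ (DualizingModule p n G) (p : ℤ) ≃+ ZMod p) ∧
    (Nonempty (DualizingModule p n G ≃+ PruferGroup p) ∨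
      ∃ s : ℕ, 1 ≤ s ∧ Nonempty (DualizingModule p n G ≃+ ZMod (p ^ s))) := by
  classical
  obtain ⟨m, rfl⟩ : ∃ m, n = m + 1 := Nat.exists_eq_succ_of_ne_zero (by omega)
  have hT : IsGPD p (m + 1) (⊤ : Subgroup G) := hG.top
  have := hT.isProPGroup.compactSpace
  obtain ⟨e⟩ := hT.top_iso
  have hvan : ∀ (U : OpenSubgroup G), ∀ f ∈ Cocycle (U : Subgroup G) (ZMod p) (m + 2),
      f ∈ Coboundary (U : Subgroup G) (ZMod p) (m + 2) := fun U f hf =>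
    mem_coboundary_of_mem_cocycle hT le_top U.isOpen hf
  -- Levels start at exponent 1, since ℤ/p⁰ has no reduction to 𝔽_p.
  let a₀ : ℕ × (OpenSubgroup G)ᵒᵈ := (1, OrderDual.toDual ⊤)
  have hdvd : ∀ a, a₀ ≤ a → p ∣ p ^ a.1 := fun a ha => dvd_pow_self p (by
    have h1 : 1 ≤ a.1 := ha.1
    omega)
  -- Reduction to 𝔽_p followed by corestriction to the whole group: surjective, with kernel the
  -- multiples of `p`, and compatible with the transition maps.
  let θ (a : ℕ × (OpenSubgroup G)ᵒᵈ) (ha : a₀ ≤ a) : LevelH p (m + 1) G a →+ ZMod p :=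
    (e.toAddMonoidHom.comp (cor (U := ⊤) le_top (OrderDual.ofDual a.2).isOpen (m + 1))).comp
      (coeffMap _ (ZMod.castHom (hdvd a ha) (ZMod p)).toAddMonoidHom (m + 1))
  obtain ⟨htors, g, hg0, hg, hgen⟩ := exists_socle_generator (p := p)
    (fun a b h => levelMap (G := G) p (m + 1) a b h) levelMap_self levelMap_levelMap
    (fun a => ⟨a.1, nsmul_eq_zero (m + 1)⟩) a₀ θ
    (fun a b ha hab x => congrArg e <|
      (cor_coeffMap_cor_coeffMap (OrderDual.ofDual_le_ofDual.2 hab.2) le_top _ _ _ _ x).trans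
        (by rw [castHom_comp_castHom]; rfl))
    (fun a ha => e.surjective.comp ((cor_surjective hT le_top (OrderDual.ofDual a.2).isOpen).comp
      (coeffMap_castHom_surjective (hvan _) _)))
    (fun a ha x hx => by
      refine exists_eq_nsmul_of_coeffMap_castHom_eq_zero (hvan _) (hdvd a ha) ?_
      refine (map_eq_zero_iff _ (cor_injective hT le_top (OrderDual.ofDual a.2).isOpen)).1 ?_
      exact (map_eq_zero_iff e e.injective).1 hx)
  exact ⟨nonempty_torsionBy_addEquiv hg hg0 hgen,
    nonempty_addEquiv_pruferGroup_or_zmod htors hg hg0 hgen⟩
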